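/- Let $T$ be the unilateral shift $Te_n=e_{n+1}$ on $\ell^2(\mathbb{Z}_+)$, let $\mathcal{T}$ be the Toeplitz algebra (the $C^*$-algebra generated by $T$), and put $T_{n,m}=T^n(T^*)^m$ for $n,m\ge 0$. Let $\Delta:\mathcal{T}\to\mathcal{T}\otimes\mathcal{T}$ (minimal tensor product) be the unique unital $*$-homomorphism with $\Delta(T)=T\otimes T$, and equip the dual space $\mathcal{T}^*$ with the product $(\rho*\varphi)(A)=(\rho\otimes\varphi)(\Delta(A))$. Let $\mathcal{K}^\perp\subset\mathcal{T}^*$ be the space of bounded functionals vanishing on the compact operators. For $V=\mathcal{T}^*$ or $V=\mathcal{K}^\perp$, a Haar functional in $V$ is a state $h\in V$ such that for every $\rho\in V$ there is $\lambda_\rho\in\mathbb{C}$ with $h*\rho=\rho*h=\lambda_\rho h$. Let $\gamma:\mathcal{T}\to C(S^1)$ be the unital $*$-homomorphism with $\gamma(T_{n,m})(e^{i\theta})=e^{i(m-n)\theta}$, and let $M(S^1)$ be the algebra of complex (regular) Borel measures on the circle with convolution. Then: 1. $\mathcal{K}^\perp$ is a subalgebra of $\mathcal{T}^*$, and the map sending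 $\mu\in M(S^1)$ to the functional $A\mapsto\int_{S^1}\gamma(A)\,d\mu$ is an algebra isomorphism of $M(S^1)$ onto $\mathcal{K}^\perp$. 2. There is exactly one Haar functional $h_0$ in $\mathcal{K}^\perp$, and $h_0(T_{n,m})=\delta_{n,m}$ for all $n,m\ge 0$. 3. There is exactly one Haar functional $h$ in $\mathcal{T}^*$, and $h_0\neq h$. 4. Under the isomorphism in 1, $h_0$ is the image of the normalized Haar (Lebesgue) measure on $S^1$. -/

import Mathlib

open scoped TensorProduct ComplexOrder ComplexConjugate

namespace ToeplitzQS

noncomputable section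

/-- The Hilbert space `ℓ²(ℤ₊)`. -/
abbrev Ell2 : Type := lp (fun _ : ℕ => ℂ) 2

/-- The standard basis vector `e_n`. -/
def stdBasis (n : ℕ) : Ell2 := lp.single 2 n (1 : ℂ)

/-- Shifting a sequence to the right. -/
def shiftFun (f : ℕ → ℂ) : ℕ → ℂ
  | 0 => 0
  | n + 1 => f n

lemma memlp_shiftFun (f : Ell2) : Memℓp (shiftFun f) 2 := by
  have h := lp.memℓp f
  rw [memℓp_gen_iff (by norm_num)] at h ⊢
  rw [← summable_nat_add_iff 1]
  simpa [shiftFun] using h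

/-- The unilateral right shift, as a linear isometry of `ℓ²(ℤ₊)`. -/
def shiftIsometry : Ell2 →ₗᵢ[ℂ] Ell2 where
  toFun f := ⟨shiftFun f, memlp_shiftFun f⟩
  map_add' f g := by
    ext n
    cases n
    · exact (add_zero (0 : ℂ)).symm
    · rfl
  map_smul' c f := by
    ext n
    cases n
    · exact (mul_zero c).symm
    · rfl
  norm_map' f := by
    have hs : Summable fun i => ‖shiftFun f i‖ ^ (2 : ENNReal).toReal :=
      (memlp_shiftFun f).summable (by norm_num)
    simp only [lp.norm_eq_tsum_rpow (p := 2) (by norm_num)]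
    congr 1
    change ∑' i, ‖shiftFun f i‖ ^ (2 : ENNReal).toReal = _
    rw [hs.tsum_eq_zero_add]
    simp [shiftFun]

/-- The right shift operator `T`, a bounded operator on `ℓ²(ℤ₊)`. -/
def shift : Ell2 →L[ℂ] Ell2 := shiftIsometry.toContinuousLinearMap

lemma shift_stdBasis (n : ℕ) : shift (stdBasis n) = stdBasis (n + 1) := by
  ext k
  change shiftFun (stdBasis n) k = _
  cases k with
  | zero => simp [shiftFun, stdBasis]
  | succ k => simp [shiftFun, stdBasis, Pi.single_apply]

lemma star_shift_mul_shift : star shift * shift = 1 := by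
  rw [ContinuousLinearMap.star_eq_adjoint]
  exact (ContinuousLinearMap.norm_map_iff_adjoint_comp_self shift).1 shiftIsometry.norm_map

/-- The Toeplitz algebra `𝒯`: the norm closed unital `*`-subalgebra of `B(ℓ²(ℤ₊))` generated by
the shift `T` (equivalently, the closed subalgebra generated by `T` and `T*`, as `T* T = 1`). -/
abbrev toeplitz : StarSubalgebra ℂ (Ell2 →L[ℂ] Ell2) := StarAlgebra.elemental ℂ shift

/-! Shortcuts for instance search. -/

instance : Ring toeplitz := inferInstance

instance : Semiring toeplitz := inferInstance

instance : Monoid toeplitz := inferInstance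

instance : AddCommMonoid toeplitz := inferInstance

instance : Algebra ℂ toeplitz := inferInstance

instance : NormedSpace ℂ toeplitz := inferInstance

instance : Module ℂ toeplitz := inferInstance

/-- The shift as an element of the Toeplitz algebra. -/
def toeplitzShift : toeplitz := ⟨shift, StarAlgebra.elemental.self_mem ℂ shift⟩

/-- The elements `T_{n,m} = Tⁿ (T*)ᵐ` of the Toeplitz algebra. -/
def monomial (n m : ℕ) : toeplitz := toeplitzShift ^ n * star toeplitzShift ^ m

/-- Two continuous unital `*`-homomorphisms on the Toeplitz algebra agree if they agree at the
shift. -/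
lemma starAlgHom_ext {B : Type*} [CStarAlgebra B] (f g : toeplitz →⋆ₐ[ℂ] B)
    (h : f toeplitzShift = g toeplitzShift) : f = g := by
  have hc (f : toeplitz →⋆ₐ[ℂ] B) : Continuous f :=
    AddMonoidHomClass.continuous_of_bound f 1 fun x => by
      simpa using NonUnitalStarAlgHom.norm_apply_le f x
  exact StarAlgebra.elemental.starAlgHomClass_ext ℂ (hc f) (hc g) h

/-! ### The symbol map -/

/-- The unit vectors `x_N = (N+1)^{-1/2} ∑_{j ≤ N} z^j e_j`, which are asymptotic
eigenvectors of `T` for the eigenvalue `z⁻¹`. -/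
def approxVec (z : Circle) (N : ℕ) : Ell2 :=
  ((Real.sqrt (N + 1) : ℝ) : ℂ)⁻¹ • ∑ j ∈ Finset.range (N + 1), ((z : ℂ) ^ j) • stdBasis j

lemma orthonormal_stdBasis : Orthonormal ℂ stdBasis := by
  classical
  rw [orthonormal_iff_ite]
  intro i j
  simp [stdBasis, lp.inner_single_left, Pi.single_apply]

lemma norm_approxVec (z : Circle) (N : ℕ) : ‖approxVec z N‖ = 1 := by
  have h0 : (0 : ℝ) < N + 1 := by positivity
  have h : ‖∑ j ∈ Finset.range (N + 1), ((z : ℂ) ^ j) • stdBasis j‖ ^ 2 = N + 1 := by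
    rw [← inner_self_eq_norm_sq (𝕜 := ℂ), orthonormal_stdBasis.inner_sum]
    have h1 (j : ℕ) : conj ((z : ℂ) ^ j) * (z : ℂ) ^ j = 1 := by
      rw [Complex.conj_mul', norm_pow, Circle.norm_coe]
      simp
    simp_rw [h1]
    simp
  have h' : ‖∑ j ∈ Finset.range (N + 1), ((z : ℂ) ^ j) • stdBasis j‖ = Real.sqrt (N + 1) := by
    rw [← h, Real.sqrt_sq (norm_nonneg _)]
  rw [approxVec, norm_smul, h', norm_inv, Complex.norm_real, Real.norm_of_nonneg (by positivity)]
  exact inv_mul_cancel₀ (by positivity)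

lemma tendsto_shift_approxVec (z : Circle) :
    Filter.Tendsto (fun N => shift (approxVec z N) - conj (z : ℂ) • approxVec z N)
      Filter.atTop (nhds 0) := by
  have key (N : ℕ) : shift (approxVec z N) - conj (z : ℂ) • approxVec z N =
      ((Real.sqrt (N + 1) : ℝ) : ℂ)⁻¹ •
        ((z : ℂ) ^ N • stdBasis (N + 1) - conj (z : ℂ) • stdBasis 0) := by
    have hz : conj (z : ℂ) * z = 1 := by simp [Complex.conj_mul', Circle.norm_coe]
    rw [approxVec, map_smul, smul_comm (conj (z : ℂ)), ← smul_sub, map_sum]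
    congr 1
    rw [Finset.smul_sum, Finset.sum_range_succ, Finset.sum_range_succ']
    have : ∑ j ∈ Finset.range N, conj (z : ℂ) • ((z : ℂ) ^ (j + 1) • stdBasis (j + 1)) =
        ∑ j ∈ Finset.range N, shift ((z : ℂ) ^ j • stdBasis j) := by
      refine Finset.sum_congr rfl fun j _ => ?_
      rw [map_smul, shift_stdBasis, smul_smul, pow_succ', ← mul_assoc, hz, one_mul]
    rw [this, map_smul, shift_stdBasis]
    simp
  simp_rw [key]
  rw [tendsto_zero_iff_norm_tendsto_zero]
  have hlim : Filter.Tendsto (fun N : ℕ => (Real.sqrt ((N : ℝ) + 1))⁻¹ * 2)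
      Filter.atTop (nhds 0) := by
    rw [show (0 : ℝ) = 0 * 2 by simp]
    refine Filter.Tendsto.mul_const _ (Filter.Tendsto.inv_tendsto_atTop ?_)
    exact Real.tendsto_sqrt_atTop.comp
      (Filter.tendsto_atTop_add_const_right _ _ tendsto_natCast_atTop_atTop)
  refine squeeze_zero (fun _ => norm_nonneg _) (fun N => ?_) hlim
  rw [norm_smul, norm_inv, Complex.norm_real, Real.norm_of_nonneg (by positivity)]
  gcongr
  refine (norm_sub_le _ _).trans ?_
  rw [norm_smul, norm_smul, orthonormal_stdBasis.1, orthonormal_stdBasis.1]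
  simp [Circle.norm_coe]
  norm_num

lemma tendsto_star_shift_approxVec (z : Circle) :
    Filter.Tendsto (fun N => star shift (approxVec z N) - (z : ℂ) • approxVec z N)
      Filter.atTop (nhds 0) := by
  have hz : (z : ℂ) * conj (z : ℂ) = 1 := by simp [Complex.mul_conj', Circle.norm_coe]
  have h1 (x : Ell2) : star shift (shift x) = x :=
    DFunLike.congr_fun star_shift_mul_shift x
  have h := (((star shift).continuous.tendsto 0).comp (tendsto_shift_approxVec z)).const_smul
    (-(z : ℂ))
  simp only [map_zero, smul_zero] at h
  refine h.congr fun N => ?_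
  simp only [Function.comp, map_sub, map_smul, h1, smul_sub, smul_smul]
  rw [neg_mul, hz]
  simp [sub_eq_add_neg, add_comm]

/-- Pairs `(A, f)` such that `A x_N - f(z) x_N → 0` and `A* x_N - conj f(z) x_N → 0`
for all `z` in the circle. -/
def symbolGraph : StarSubalgebra ℂ ((Ell2 →L[ℂ] Ell2) × C(Circle, ℂ)) where
  carrier := {p | ∀ z : Circle,
    Filter.Tendsto (fun N => p.1 (approxVec z N) - p.2 z • approxVec z N)
      Filter.atTop (nhds 0) ∧
    Filter.Tendsto (fun N => star p.1 (approxVec z N) - conj (p.2 z) • approxVec z N)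
      Filter.atTop (nhds 0)}
  mul_mem' {p q} hp hq z := by
    constructor
    · have h := ((p.1.continuous.tendsto 0).comp (hq z).1).add ((hp z).1.const_smul (q.2 z))
      simp only [map_zero, smul_zero, add_zero] at h
      refine h.congr fun N => ?_
      simp [smul_sub, smul_smul, mul_comm]
    · have h := (((star q.1).continuous.tendsto 0).comp (hp z).2).add
        ((hq z).2.const_smul (conj (p.2 z)))
      simp only [map_zero, smul_zero, add_zero] at h
      refine h.congr fun N => ?_
      simp [smul_sub, smul_smul]
  add_mem' {p q} hp hq z := by
    constructor
    · have h := (hp z).1.add (hq z).1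
      rw [add_zero] at h
      refine h.congr fun N => ?_
      simp only [Prod.fst_add, Prod.snd_add, ContinuousMap.add_apply, add_smul,
        add_apply]
      abel
    · have h := (hp z).2.add (hq z).2
      rw [add_zero] at h
      refine h.congr fun N => ?_
      simp only [Prod.fst_add, Prod.snd_add, ContinuousMap.add_apply, add_smul, star_add, map_add,
        add_apply]
      abel
  algebraMap_mem' c z := by
    constructor
    · simp [Algebra.algebraMap_eq_smul_one]
    · simp [Algebra.algebraMap_eq_smul_one]
  star_mem' {p} hp z := by
    refine ⟨?_, ?_⟩
    · simpa using (hp z).2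
    · simpa using (hp z).1

lemma mem_symbolGraph {p : (Ell2 →L[ℂ] Ell2) × C(Circle, ℂ)} :
    p ∈ symbolGraph ↔ ∀ z : Circle,
    Filter.Tendsto (fun N => p.1 (approxVec z N) - p.2 z • approxVec z N)
      Filter.atTop (nhds 0) ∧
    Filter.Tendsto (fun N => star p.1 (approxVec z N) - conj (p.2 z) • approxVec z N)
      Filter.atTop (nhds 0) := Iff.rfl

lemma norm_symbol_le {p : (Ell2 →L[ℂ] Ell2) × C(Circle, ℂ)} (hp : p ∈ symbolGraph) :
    ‖p.2‖ ≤ ‖p.1‖ := by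
  rw [ContinuousMap.norm_le _ (norm_nonneg _)]
  intro z
  have h := ((hp z).1.norm).const_add ‖p.1‖
  rw [norm_zero, add_zero] at h
  refine ge_of_tendsto' h fun N => ?_
  have h1 : ‖p.2 z • approxVec z N‖ = ‖p.2 z‖ := by rw [norm_smul, norm_approxVec, mul_one]
  have h2 : ‖p.1 (approxVec z N)‖ ≤ ‖p.1‖ := by
    simpa [norm_approxVec] using p.1.le_opNorm (approxVec z N)
  rw [← h1]
  calc _ = ‖p.1 (approxVec z N) - (p.1 (approxVec z N) - p.2 z • approxVec z N)‖ := by simp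
    _ ≤ _ := (norm_sub_le _ _).trans (by gcongr)

lemma isClosed_symbolGraph : IsClosed (symbolGraph : Set ((Ell2 →L[ℂ] Ell2) × C(Circle, ℂ))) := by
  have aux (z : Circle) (q : ℕ → (Ell2 →L[ℂ] Ell2) × ℂ) (p : (Ell2 →L[ℂ] Ell2) × ℂ)
      (hq : Filter.Tendsto q Filter.atTop (nhds p))
      (h : ∀ k, Filter.Tendsto (fun N => (q k).1 (approxVec z N) - (q k).2 • approxVec z N)
        Filter.atTop (nhds 0)) :
      Filter.Tendsto (fun N => p.1 (approxVec z N) - p.2 • approxVec z N)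
        Filter.atTop (nhds 0) := by
    rw [Metric.tendsto_atTop] at hq ⊢
    intro ε hε
    obtain ⟨k, hk⟩ := hq (ε / 3) (by positivity)
    specialize hk k le_rfl
    obtain ⟨M, hM⟩ := (Metric.tendsto_atTop.1 (h k)) (ε / 3) (by positivity)
    refine ⟨M, fun N hN => ?_⟩
    specialize hM N hN
    rw [dist_zero_right] at hM ⊢
    rw [dist_comm, dist_eq_norm] at hk
    have h1 : ‖(p.1 - (q k).1) (approxVec z N)‖ ≤ ‖p.1 - (q k).1‖ := by
      simpa [norm_approxVec] using (p.1 - (q k).1).le_opNorm (approxVec z N)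
    have h2 : ‖(p.2 - (q k).2) • approxVec z N‖ = ‖p.2 - (q k).2‖ := by
      rw [norm_smul, norm_approxVec, mul_one]
    have h3 : ‖p.1 - (q k).1‖ ≤ ‖p - q k‖ := norm_fst_le (p - q k)
    have h4 : ‖p.2 - (q k).2‖ ≤ ‖p - q k‖ := norm_snd_le (p - q k)
    have h5 : p.1 (approxVec z N) - p.2 • approxVec z N =
        (p.1 - (q k).1) (approxVec z N) - (p.2 - (q k).2) • approxVec z N +
        ((q k).1 (approxVec z N) - (q k).2 • approxVec z N) := by
      simp only [sub_apply, sub_smul]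
      abel
    rw [h5]
    refine (norm_add_le _ _).trans_lt ?_
    have := norm_sub_le ((p.1 - (q k).1) (approxVec z N)) ((p.2 - (q k).2) • approxVec z N)
    linarith
  refine IsSeqClosed.isClosed fun q p hq hp z => ⟨?_, ?_⟩
  · refine aux z (fun k => ((q k).1, (q k).2 z)) (p.1, p.2 z) ?_ (fun k => (hq k z).1)
    exact (((continuous_fst.prodMk
      ((continuous_eval_const z).comp continuous_snd)).tendsto p).comp hp)
  · refine aux z (fun k => (star (q k).1, conj ((q k).2 z))) (star p.1, conj (p.2 z)) ?_
      (fun k => (hq k z).2)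
    exact ((((continuous_star.comp continuous_fst).prodMk
      (Complex.continuous_conj.comp
        ((continuous_eval_const z).comp continuous_snd))).tendsto p).comp hp)

/-- The continuous function `z ↦ z` on the circle. -/
def circleVar : C(Circle, ℂ) := ⟨fun z => z, by fun_prop⟩

@[simp] lemma circleVar_apply (z : Circle) : circleVar z = z := rfl

/-- There is a unique unital `*`-homomorphism `γ : 𝒯 → C(S¹)` with `γ(T) = e^{-iθ}`. -/
lemma existsUnique_symbol :
    ∃! γ : toeplitz →⋆ₐ[ℂ] C(Circle, ℂ), γ toeplitzShift = star circleVar := by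
  let π : symbolGraph →⋆ₐ[ℂ] (Ell2 →L[ℂ] Ell2) :=
    (StarAlgHom.fst ℂ (Ell2 →L[ℂ] Ell2) C(Circle, ℂ)).comp symbolGraph.subtype
  have hπ : Isometry π := by
    refine AddMonoidHomClass.isometry_of_norm π fun p => ?_
    change ‖p.1.1‖ = ‖p.1‖
    rw [Prod.norm_def, max_eq_left (norm_symbol_le p.2)]
  have : CompleteSpace symbolGraph := isClosed_symbolGraph.completeSpace_coe
  have hmem : ((shift, star circleVar) : (Ell2 →L[ℂ] Ell2) × C(Circle, ℂ)) ∈ symbolGraph := by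
    intro z
    exact ⟨tendsto_shift_approxVec z, by simpa using tendsto_star_shift_approxVec z⟩
  have hle : toeplitz ≤ π.range := by
    refine StarAlgebra.elemental.le_of_mem ?_ ⟨⟨_, hmem⟩, rfl⟩
    exact hπ.isClosedEmbedding.isClosed_range
  let E := StarAlgEquiv.ofInjective π hπ.injective
  let γ : toeplitz →⋆ₐ[ℂ] C(Circle, ℂ) :=
    (StarAlgHom.snd ℂ (Ell2 →L[ℂ] Ell2) C(Circle, ℂ)).comp (symbolGraph.subtype.comp
      ((E.symm : π.range →⋆ₐ[ℂ] symbolGraph).comp (StarSubalgebra.inclusion hle)))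
  have h0 : γ toeplitzShift = star circleVar := by
    have : E.symm (StarSubalgebra.inclusion hle toeplitzShift) = ⟨_, hmem⟩ := by
      rw [StarAlgEquiv.symm_apply_eq]
      rfl
    change (E.symm (StarSubalgebra.inclusion hle toeplitzShift)).1.2 = _
    rw [this]
  refine ⟨γ, h0, ?_⟩
  · intro g hg
    exact starAlgHom_ext _ _ (hg.trans h0.symm)

/-! ### Tensor products of operators and functionals -/

/-- The Hilbert space tensor product: the completion of the algebraic tensor product. -/
def HTensor (E F : Type*) [NormedAddCommGroup E] [InnerProductSpace ℂ E]
    [NormedAddCommGroup F] [InnerProductSpace ℂ F] : Type _ :=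
  UniformSpace.Completion (E ⊗[ℂ] F)

section tensor

variable {E F : Type*} [NormedAddCommGroup E] [InnerProductSpace ℂ E]
  [NormedAddCommGroup F] [InnerProductSpace ℂ F]

instance : NormedAddCommGroup (HTensor E F) :=
  inferInstanceAs (NormedAddCommGroup (UniformSpace.Completion (E ⊗[ℂ] F)))

instance : InnerProductSpace ℂ (HTensor E F) :=
  inferInstanceAs (InnerProductSpace ℂ (UniformSpace.Completion (E ⊗[ℂ] F)))

instance : CompleteSpace (HTensor E F) :=
  inferInstanceAs (CompleteSpace (UniformSpace.Completion (E ⊗[ℂ] F)))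

/-- The vector `x ⊗ y` of the Hilbert space tensor product, bilinear and continuous. -/
def vecTensor : E →L[ℂ] F →L[ℂ] HTensor E F :=
  (ContinuousLinearMap.compL ℂ F (E ⊗[ℂ] F) (HTensor E F)
    (UniformSpace.Completion.toComplL : E ⊗[ℂ] F →L[ℂ] UniformSpace.Completion (E ⊗[ℂ] F))).comp
    (TensorProduct.mkL ℂ E F)

lemma vecTensor_apply (x : E) (y : F) :
    vecTensor x y = ((x ⊗ₜ[ℂ] y : E ⊗[ℂ] F) : UniformSpace.Completion (E ⊗[ℂ] F)) := rfl

/-- The operator `A ⊗ B` on the Hilbert space tensor product. -/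
def opTensor (A : E →L[ℂ] E) (B : F →L[ℂ] F) : HTensor E F →L[ℂ] HTensor E F :=
  (TensorProduct.mapL A B).completion

lemma opTensor_vecTensor (A : E →L[ℂ] E) (B : F →L[ℂ] F) (x : E) (y : F) :
    opTensor A B (vecTensor x y) = vecTensor (A x) (B y) := by
  exact (ContinuousLinearMap.completion_apply_coe _ _).trans rfl

lemma inner_vecTensor (x x' : E) (y y' : F) :
    inner ℂ (vecTensor x y) (vecTensor x' y') = inner ℂ x x' * inner ℂ y y' := by
  exact (UniformSpace.Completion.inner_coe _ _).trans (TensorProduct.inner_tmul _ _ _ _ _)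

lemma norm_vecTensor (x : E) (y : F) : ‖vecTensor x y‖ = ‖x‖ * ‖y‖ := by
  exact (UniformSpace.Completion.norm_coe _).trans (TensorProduct.norm_tmul _ _)

/-- A closed subspace containing all `x ⊗ y` is everything. -/
lemma eq_top_of_vecTensor_mem (M : Submodule ℂ (HTensor E F))
    (hM : IsClosed (M : Set (HTensor E F))) (h : ∀ x y, vecTensor x y ∈ M) : M = ⊤ := by
  refine Submodule.eq_top_iff'.2 fun v => ?_
  induction v using UniformSpace.Completion.induction_on with
  | hp => exact hM
  | ih t =>
    induction t using TensorProduct.induction_on with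
    | zero => exact M.zero_mem
    | tmul x y => exact h x y
    | add a b ha hb =>
      rw [UniformSpace.Completion.coe_add]
      exact M.add_mem (x := (a : UniformSpace.Completion (E ⊗[ℂ] F))) ha hb

/-- A closed subspace containing all `u_i ⊗ v_j`, for total families `u` and `v`, is everything. -/
lemma eq_top_of_total {ι κ : Type*} {u : ι → E} {v : κ → F}
    (hu : (Submodule.span ℂ (Set.range u)).topologicalClosure = ⊤)
    (hv : (Submodule.span ℂ (Set.range v)).topologicalClosure = ⊤)
    (M : Submodule ℂ (HTensor E F)) (hM : IsClosed (M : Set (HTensor E F)))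
    (h : ∀ i j, vecTensor (u i) (v j) ∈ M) : M = ⊤ := by
  have h1 (x : E) (j : κ) : vecTensor x (v j) ∈ M := by
    have : (Submodule.span ℂ (Set.range u)).topologicalClosure ≤
        M.comap ((vecTensor : E →L[ℂ] F →L[ℂ] HTensor E F).flip (v j)).toLinearMap := by
      refine Submodule.topologicalClosure_minimal _ (Submodule.span_le.2 ?_)
        (hM.preimage (ContinuousLinearMap.continuous _))
      rintro _ ⟨i, rfl⟩
      exact h i j
    exact (this.trans' hu.ge) (Submodule.mem_top (x := x))
  refine eq_top_of_vecTensor_mem M hM fun x y => ?_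
  have : (Submodule.span ℂ (Set.range v)).topologicalClosure ≤
      M.comap ((vecTensor : E →L[ℂ] F →L[ℂ] HTensor E F) x).toLinearMap := by
    refine Submodule.topologicalClosure_minimal _ (Submodule.span_le.2 ?_)
      (hM.preimage (ContinuousLinearMap.continuous _))
    rintro _ ⟨j, rfl⟩
    exact h1 x j
  exact (this.trans' hv.ge) (Submodule.mem_top (x := y))

lemma clm_ext_vecTensor {G : Type*} [NormedAddCommGroup G] [NormedSpace ℂ G]
    {f g : HTensor E F →L[ℂ] G} (h : ∀ x y, f (vecTensor x y) = g (vecTensor x y)) : f = g := by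
  have := eq_top_of_vecTensor_mem (LinearMap.eqLocus f.toLinearMap g.toLinearMap)
    (isClosed_eq f.continuous g.continuous) h
  ext v
  exact (this.ge (Submodule.mem_top (x := v)) :)

lemma opTensor_one_one : opTensor (1 : E →L[ℂ] E) (1 : F →L[ℂ] F) = 1 :=
  clm_ext_vecTensor fun x y => by simp [opTensor_vecTensor]

lemma opTensor_mul (A A' : E →L[ℂ] E) (B B' : F →L[ℂ] F) :
    opTensor A B * opTensor A' B' = opTensor (A * A') (B * B') :=
  clm_ext_vecTensor fun x y => by simp [opTensor_vecTensor]

lemma star_opTensor [CompleteSpace E] [CompleteSpace F] (A : E →L[ℂ] E) (B : F →L[ℂ] F) :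
    star (opTensor A B) = opTensor (star A) (star B) := by
  refine clm_ext_vecTensor fun x y => ?_
  have : (⊤ : Submodule ℂ (HTensor E F)) ≤ LinearMap.ker
      (innerSL ℂ (star (opTensor A B) (vecTensor x y) -
        opTensor (star A) (star B) (vecTensor x y))).toLinearMap := by
    refine (eq_top_of_vecTensor_mem _ (ContinuousLinearMap.isClosed_ker _) fun x' y' => ?_).ge
    simp [ContinuousLinearMap.star_eq_adjoint, ContinuousLinearMap.adjoint_inner_left, opTensor_vecTensor, inner_vecTensor]
  rw [← sub_eq_zero, ← inner_self_eq_zero (𝕜 := ℂ)]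
  exact this Submodule.mem_top

lemma opTensor_add_left (A A' : E →L[ℂ] E) (B : F →L[ℂ] F) :
    opTensor (A + A') B = opTensor A B + opTensor A' B :=
  clm_ext_vecTensor fun x y => by simp [opTensor_vecTensor]

lemma opTensor_smul_left (c : ℂ) (A : E →L[ℂ] E) (B : F →L[ℂ] F) :
    opTensor (c • A) B = c • opTensor A B :=
  clm_ext_vecTensor fun x y => by simp [opTensor_vecTensor]

/-- The amplification `A ↦ A ⊗ 1`. -/
def amplification [CompleteSpace E] [CompleteSpace F] :
    (E →L[ℂ] E) →⋆ₐ[ℂ] (HTensor E F →L[ℂ] HTensor E F) where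
  toFun A := opTensor A 1
  map_one' := opTensor_one_one
  map_mul' A B := by rw [opTensor_mul, one_mul]
  map_zero' := by simpa using opTensor_smul_left (0 : ℂ) (0 : E →L[ℂ] E) (1 : F →L[ℂ] F)
  map_add' A B := opTensor_add_left A B 1
  commutes' c := by
    rw [Algebra.algebraMap_eq_smul_one, opTensor_smul_left, opTensor_one_one,
      Algebra.algebraMap_eq_smul_one]
  map_star' A := by rw [star_opTensor, star_one]

/-- Bounded functionals `ρ`, `φ` on `B(E)`, `B(F)` have a bounded tensor product on `B(E ⊗ F)`. -/
lemma exists_functional_tensor [CompleteSpace E] [CompleteSpace F]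
    (ρ : StrongDual ℂ (E →L[ℂ] E)) (φ : StrongDual ℂ (F →L[ℂ] F)) :
    ∃ Φ : StrongDual ℂ (HTensor E F →L[ℂ] HTensor E F),
      ∀ A B, Φ (opTensor A B) = ρ A * φ B := by
  let V : F →L[ℂ] E →L[ℂ] HTensor E F := (vecTensor : E →L[ℂ] F →L[ℂ] HTensor E F).flip
  have hV (y : F) : ‖V y‖ ≤ ‖y‖ :=
    ContinuousLinearMap.opNorm_le_bound _ (norm_nonneg _) fun x => by
      change ‖vecTensor x y‖ ≤ _
      rw [norm_vecTensor, mul_comm]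
  have hbd (U : HTensor E F →L[ℂ] HTensor E F) (η ξ : F) :
      ‖ρ ((V η).adjoint ∘L U ∘L V ξ)‖ ≤ ‖ρ‖ * ‖U‖ * ‖η‖ * ‖ξ‖ := by
    refine (ρ.le_opNorm _).trans ?_
    rw [mul_assoc, mul_assoc]
    gcongr
    refine (ContinuousLinearMap.opNorm_comp_le _ _).trans ?_
    rw [LinearIsometryEquiv.norm_map]
    calc ‖V η‖ * ‖U ∘L V ξ‖ ≤ ‖η‖ * (‖U‖ * ‖ξ‖) := by
          gcongr
          · exact hV η
          · exact (ContinuousLinearMap.opNorm_comp_le _ _).trans (by gcongr; exact hV ξ)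
      _ = _ := by ring
  let Q (U : HTensor E F →L[ℂ] HTensor E F) : F →L⋆[ℂ] F →L[ℂ] ℂ :=
    LinearMap.mkContinuous₂
      (LinearMap.mk₂'ₛₗ (starRingEnd ℂ) (RingHom.id ℂ)
        (fun η ξ => ρ ((V η).adjoint ∘L U ∘L V ξ))
        (fun η η' ξ => by simp)
        (fun c η ξ => by
          rw [map_smul, map_smulₛₗ, ContinuousLinearMap.smul_comp, map_smul])
        (fun η ξ ξ' => by simp)
        (fun c η ξ => by simp))
      (‖ρ‖ * ‖U‖) (hbd U)
  let S (U : HTensor E F →L[ℂ] HTensor E F) : F →L[ℂ] F :=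
    (InnerProductSpace.continuousLinearMapOfBilin (Q U)).adjoint
  have hS (U : HTensor E F →L[ℂ] HTensor E F) (η ξ : F) :
      inner ℂ η (S U ξ) = ρ ((V η).adjoint ∘L U ∘L V ξ) := by
    rw [ContinuousLinearMap.adjoint_inner_right,
      InnerProductSpace.continuousLinearMapOfBilin_apply]
    rfl
  have hSn (U : HTensor E F →L[ℂ] HTensor E F) : ‖S U‖ ≤ ‖ρ‖ * ‖U‖ := by
    refine ContinuousLinearMap.opNorm_le_bound _ (by positivity) fun ξ => ?_
    have h := hbd U (S U ξ) ξ
    rw [← hS, inner_self_eq_norm_sq_to_K, norm_pow, RCLike.norm_ofReal, abs_norm, sq,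
      mul_right_comm] at h
    rcases (norm_nonneg (S U ξ)).eq_or_lt with h0 | h0
    · rw [← h0]
      positivity
    · exact le_of_mul_le_mul_right h h0
  let L : (HTensor E F →L[ℂ] HTensor E F) →ₗ[ℂ] ℂ :=
    { toFun := fun U => φ (S U)
      map_add' := fun U U' => by
        rw [← map_add]
        congr 1
        ext1 ξ
        refine ext_inner_left ℂ fun η => ?_
        simp [hS, inner_add_right]
      map_smul' := fun c U => by
        rw [RingHom.id_apply, ← map_smul]
        congr 1
        ext1 ξ
        refine ext_inner_left ℂ fun η => ?_
        simp [hS, inner_smul_right] }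
  have hL (U : HTensor E F →L[ℂ] HTensor E F) : ‖L U‖ ≤ ‖φ‖ * ‖ρ‖ * ‖U‖ := by
    refine (φ.le_opNorm _).trans ?_
    rw [mul_assoc]
    gcongr
    exact hSn U
  let Φ : StrongDual ℂ (HTensor E F →L[ℂ] HTensor E F) := L.mkContinuous (‖φ‖ * ‖ρ‖) hL
  refine ⟨Φ, fun A B => ?_⟩
  · change φ (S (opTensor A B)) = _
    have : S (opTensor A B) = ρ A • B := by
      ext1 ξ
      refine ext_inner_left ℂ fun η => ?_
      have h2 : (V η).adjoint ∘L opTensor A B ∘L V ξ = inner ℂ η (B ξ) • A := by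
        ext1 x
        refine ext_inner_left ℂ fun x' => ?_
        have h3 (x : E) (y : F) : V y x = vecTensor x y := rfl
        simp [ContinuousLinearMap.adjoint_inner_right, h3, opTensor_vecTensor, inner_vecTensor,
          inner_smul_right, mul_comm]
      rw [hS, h2]
      simp [inner_smul_right, mul_comm]
    rw [this]
    simp

end tensor

/-! ### The comultiplication -/

/-- The minimal tensor product `𝒯 ⊗ 𝒯`: the norm closure, inside the bounded operators on
`ℓ²(ℤ₊) ⊗ ℓ²(ℤ₊)`, of the `*`-algebra generated by the operators `a ⊗ b` with `a, b ∈ 𝒯`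
(which is the linear span of these operators). -/
abbrev minTensor : StarSubalgebra ℂ (HTensor Ell2 Ell2 →L[ℂ] HTensor Ell2 Ell2) :=
  (StarAlgebra.adjoin ℂ (Set.range fun p : toeplitz × toeplitz =>
    opTensor (p.1 : Ell2 →L[ℂ] Ell2) (p.2 : Ell2 →L[ℂ] Ell2))).topologicalClosure

instance : CStarAlgebra minTensor :=
  StarSubalgebra.cstarAlgebra _ (h_closed := StarSubalgebra.isClosed_topologicalClosure _)

/-! Shortcuts for instance search. -/

instance : Ring minTensor := inferInstance

instance : Semiring minTensor := inferInstance

instance : Monoid minTensor := inferInstance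

instance : AddCommMonoid minTensor := inferInstance

instance : Algebra ℂ minTensor := inferInstance

instance : NormedSpace ℂ minTensor := inferInstance

instance : Module ℂ minTensor := inferInstance

/-- The element `a ⊗ b` of `𝒯 ⊗ 𝒯`. -/
def tensorElem (a b : toeplitz) : minTensor :=
  ⟨opTensor (a : Ell2 →L[ℂ] Ell2) (b : Ell2 →L[ℂ] Ell2),
    StarSubalgebra.le_topologicalClosure _ (StarAlgebra.subset_adjoin ℂ _ ⟨(a, b), rfl⟩)⟩

lemma closure_span_tensorElem :
    (Submodule.span ℂ (Set.range fun p : toeplitz × toeplitz =>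
      tensorElem p.1 p.2)).topologicalClosure = ⊤ := by
  set s : Set (HTensor Ell2 Ell2 →L[ℂ] HTensor Ell2 Ell2) :=
    Set.range fun p : toeplitz × toeplitz =>
      opTensor (p.1 : Ell2 →L[ℂ] Ell2) (p.2 : Ell2 →L[ℂ] Ell2) with hs
  let M : Submonoid (HTensor Ell2 Ell2 →L[ℂ] HTensor Ell2 Ell2) :=
    { carrier := s
      mul_mem' := by
        rintro _ _ ⟨p, rfl⟩ ⟨q, rfl⟩
        exact ⟨(p.1 * q.1, p.2 * q.2), (opTensor_mul _ _ _ _).symm⟩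
      one_mem' := ⟨(1, 1), opTensor_one_one⟩ }
  have hstar : s ∪ star s = s := by
    refine Set.union_eq_self_of_subset_right ?_
    rintro x ⟨p, hp⟩
    refine ⟨(star p.1, star p.2), ?_⟩
    have := congrArg star hp
    rw [star_star] at this
    rw [← this]
    exact (star_opTensor _ _).symm
  have hspan : ((StarAlgebra.adjoin ℂ s : StarSubalgebra ℂ _) : Set _) =
      (Submodule.span ℂ s : Set (HTensor Ell2 Ell2 →L[ℂ] HTensor Ell2 Ell2)) := by
    have h1 := Algebra.adjoin_eq_span ℂ s
    rw [show Submonoid.closure s = M from Submonoid.closure_eq M] at h1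
    have h2 := StarAlgebra.adjoin_toSubalgebra ℂ s
    rw [hstar] at h2
    change _ = ((Submodule.span ℂ (M : Set (HTensor Ell2 Ell2 →L[ℂ] HTensor Ell2 Ell2)) :
      Submodule ℂ (HTensor Ell2 Ell2 →L[ℂ] HTensor Ell2 Ell2)) :
      Set (HTensor Ell2 Ell2 →L[ℂ] HTensor Ell2 Ell2))
    rw [← h1, ← h2]
    rfl
  refine Submodule.eq_top_iff'.2 fun x => ?_
  have hx : (x : HTensor Ell2 Ell2 →L[ℂ] HTensor Ell2 Ell2) ∈
      closure (Submodule.span ℂ s : Set (HTensor Ell2 Ell2 →L[ℂ] HTensor Ell2 Ell2)) := by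
    rw [← hspan]
    exact x.2
  change x ∈ closure _
  rw [closure_subtype]
  convert hx using 2
  have : s = (minTensor.subtype : minTensor →ₗ[ℂ] _) ''
      (Set.range fun p : toeplitz × toeplitz => tensorElem p.1 p.2) := by
    rw [← Set.range_comp]
    rfl
  rw [this, Submodule.span_image]
  rfl

/-- The vectors `e_{k + d⁺} ⊗ e_{k + d⁻}`, an enumeration of the basis `e_a ⊗ e_b` by
`k = min a b` and `d = a - b`. -/
def diagVec (p : ℕ × ℤ) : HTensor Ell2 Ell2 :=
  vecTensor (stdBasis (p.1 + p.2.toNat)) (stdBasis (p.1 + (-p.2).toNat))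

lemma closure_span_single {ι : Type*} [DecidableEq ι] :
    (Submodule.span ℂ (Set.range fun i : ι =>
      (lp.single 2 i (1 : ℂ) : lp (fun _ : ι => ℂ) 2))).topologicalClosure = ⊤ := by
  refine Submodule.eq_top_iff'.2 fun f => ?_
  refine mem_closure_of_tendsto (lp.hasSum_single (by norm_num) f)
    (Filter.Eventually.of_forall fun s => Submodule.sum_mem _ fun i _ => ?_)
  have : lp.single 2 i (f i) = f i • (lp.single 2 i (1 : ℂ) : lp (fun _ : ι => ℂ) 2) := by
    rw [← lp.single_smul]
    simp
  rw [this]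
  exact Submodule.smul_mem _ _ (Submodule.subset_span ⟨i, rfl⟩)

lemma closure_span_stdBasis :
    (Submodule.span ℂ (Set.range stdBasis)).topologicalClosure = ⊤ := closure_span_single

/-- There is a unique unital `*`-homomorphism `Δ : 𝒯 → 𝒯 ⊗ 𝒯` with `Δ(T) = T ⊗ T`. -/
lemma existsUnique_comul :
    ∃! Δ : toeplitz →⋆ₐ[ℂ] minTensor, Δ toeplitzShift = tensorElem toeplitzShift toeplitzShift := by
  classical
  let δ : ℤ → lp (fun _ : ℤ => ℂ) 2 := fun d => lp.single 2 d (1 : ℂ)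
  have hδ : Orthonormal ℂ δ := by
    rw [orthonormal_iff_ite]
    intro i j
    simp [δ, lp.inner_single_left, Pi.single_apply]
  have hδt : (Submodule.span ℂ (Set.range δ)).topologicalClosure = ⊤ := closure_span_single
  have h1 : Orthonormal ℂ diagVec := by
    rw [orthonormal_iff_ite]
    rintro ⟨k, d⟩ ⟨k', d'⟩
    rw [diagVec, diagVec, inner_vecTensor, orthonormal_iff_ite.1 orthonormal_stdBasis,
      orthonormal_iff_ite.1 orthonormal_stdBasis]
    have : (k = k' ∧ d = d') ↔
      (k + d.toNat = k' + d'.toNat ∧ k + (-d).toNat = k' + (-d').toNat) := by omega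
    simp only [Prod.mk.injEq, this, ite_and]
    split_ifs <;> simp
  have h1t : (Submodule.span ℂ (Set.range diagVec)).topologicalClosure = ⊤ := by
    refine eq_top_of_total closure_span_stdBasis closure_span_stdBasis _
      (Submodule.isClosed_topologicalClosure _) fun a b => ?_
    refine Submodule.le_topologicalClosure _ (Submodule.subset_span
      ⟨(min a b, (a : ℤ) - b), ?_⟩)
    rw [diagVec]
    congr 2 <;> congr 1 <;> omega
  let w : ℕ × ℤ → HTensor Ell2 (lp (fun _ : ℤ => ℂ) 2) := fun p => vecTensor (stdBasis p.1) (δ p.2)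
  have h2 : Orthonormal ℂ w := by
    rw [orthonormal_iff_ite]
    rintro ⟨k, d⟩ ⟨k', d'⟩
    simp only [w]
    rw [inner_vecTensor, orthonormal_iff_ite.1 orthonormal_stdBasis,
      orthonormal_iff_ite.1 hδ]
    simp only [Prod.mk.injEq, ite_and]
    split_ifs <;> simp
  have h2t : (Submodule.span ℂ (Set.range w)).topologicalClosure = ⊤ :=
    eq_top_of_total closure_span_stdBasis hδt _
      (Submodule.isClosed_topologicalClosure _) fun a b =>
        Submodule.le_topologicalClosure _ (Submodule.subset_span ⟨(a, b), rfl⟩)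
  let b1 := HilbertBasis.mk h1 h1t.ge
  let b2 := HilbertBasis.mk h2 h2t.ge
  let W : HTensor Ell2 Ell2 ≃ₗᵢ[ℂ] HTensor Ell2 (lp (fun _ : ℤ => ℂ) 2) :=
    b1.repr.trans b2.repr.symm
  have hW (p : ℕ × ℤ) : W (diagVec p) = w p := by
    have e1 : b1 p = diagVec p := congrFun (HilbertBasis.coe_mk h1 h1t.ge) p
    have e2 : b2 p = w p := congrFun (HilbertBasis.coe_mk h2 h2t.ge) p
    rw [← e1, ← e2]
    simp [W, HilbertBasis.repr_self]
  have hW' (p : ℕ × ℤ) : W.symm (w p) = diagVec p := by rw [← hW, W.symm_apply_apply]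
  let Ψ : (Ell2 →L[ℂ] Ell2) →⋆ₐ[ℂ] (HTensor Ell2 Ell2 →L[ℂ] HTensor Ell2 Ell2) :=
    (StarAlgHomClass.toStarAlgHom W.symm.conjStarAlgEquiv).comp amplification
  have hΨ : Ψ shift = opTensor shift shift := by
    have : (⊤ : Submodule ℂ (HTensor Ell2 Ell2)) ≤
        LinearMap.eqLocus (Ψ shift).toLinearMap (opTensor shift shift).toLinearMap := by
      rw [← h1t]
      refine Submodule.topologicalClosure_minimal _ (Submodule.span_le.2 ?_)
        (isClosed_eq (Ψ shift).continuous (opTensor shift shift).continuous)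
      rintro _ ⟨⟨k, d⟩, rfl⟩
      change W.symm (opTensor shift 1 (W (diagVec (k, d)))) = opTensor shift shift (diagVec (k, d))
      rw [hW]
      have e1 : opTensor shift 1 (w (k, d)) = w (k + 1, d) := by
        simp only [w, opTensor_vecTensor, shift_stdBasis]
        rfl
      rw [e1, hW', diagVec, diagVec, opTensor_vecTensor, shift_stdBasis, shift_stdBasis,
        Nat.add_right_comm, Nat.add_right_comm k 1]
    ext1 v
    exact this (Submodule.mem_top (x := v))
  have hΨc : Continuous Ψ :=
    AddMonoidHomClass.continuous_of_bound Ψ 1 fun x => by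
      simpa using NonUnitalStarAlgHom.norm_apply_le Ψ x
  have hle : toeplitz ≤ minTensor.comap Ψ := by
    refine StarAlgebra.elemental.le_of_mem
      ((StarSubalgebra.isClosed_topologicalClosure _).preimage hΨc) ?_
    change Ψ shift ∈ minTensor
    rw [hΨ]
    exact (tensorElem toeplitzShift toeplitzShift).2
  have h0 : (Ψ.comp toeplitz.subtype).codRestrict minTensor (fun a => hle a.2) toeplitzShift =
      tensorElem toeplitzShift toeplitzShift := Subtype.ext hΨ
  exact ⟨_, h0, fun g hg => starAlgHom_ext _ _ (hg.trans h0.symm)⟩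

/-- The comultiplication `Δ : 𝒯 → 𝒯 ⊗ 𝒯`, the unital `*`-homomorphism with `Δ(T) = T ⊗ T`. -/
def comul : toeplitz →⋆ₐ[ℂ] minTensor := existsUnique_comul.choose

lemma comul_shift : comul toeplitzShift = tensorElem toeplitzShift toeplitzShift :=
  existsUnique_comul.choose_spec.1

/-- For `ρ, φ ∈ 𝒯*` there is a unique bounded functional on `𝒯 ⊗ 𝒯` with
`a ⊗ b ↦ ρ(a) φ(b)`. -/
lemma existsUnique_tensorFunctional (ρ φ : StrongDual ℂ toeplitz) :
    ∃! Φ : StrongDual ℂ minTensor, ∀ a b, Φ (tensorElem a b) = ρ a * φ b := by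
  obtain ⟨ρ', hρ', -⟩ := exists_extension_norm_eq toeplitz.toSubalgebra.toSubmodule ρ
  obtain ⟨φ', hφ', -⟩ := exists_extension_norm_eq toeplitz.toSubalgebra.toSubmodule φ
  obtain ⟨Φ, hΦ⟩ := exists_functional_tensor ρ' φ'
  have h0 : ∀ a b : toeplitz, Φ (tensorElem a b : HTensor Ell2 Ell2 →L[ℂ] HTensor Ell2 Ell2) =
      ρ a * φ b := fun a b => by
    rw [← hρ' a, ← hφ' b]
    exact hΦ a b
  refine ⟨Φ.comp (minTensor.toSubalgebra.toSubmodule.subtypeL), h0, fun Φ' h' => ?_⟩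
  have : (⊤ : Submodule ℂ minTensor) ≤ LinearMap.eqLocus Φ'.toLinearMap
      (Φ.comp (minTensor.toSubalgebra.toSubmodule.subtypeL)).toLinearMap := by
    rw [← closure_span_tensorElem]
    refine Submodule.topologicalClosure_minimal _ (Submodule.span_le.2 ?_)
      (isClosed_eq Φ'.continuous (ContinuousLinearMap.continuous _))
    rintro _ ⟨⟨a, b⟩, rfl⟩
    exact (h' a b).trans (h0 a b).symm
  ext v
  exact this (Submodule.mem_top (x := v))

/-- The functional `ρ ⊗ φ` on `𝒯 ⊗ 𝒯`, the bounded functional with `a ⊗ b ↦ ρ(a) φ(b)`. -/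
def tensorFunctional (ρ φ : StrongDual ℂ toeplitz) : StrongDual ℂ minTensor :=
  (existsUnique_tensorFunctional ρ φ).choose

lemma tensorFunctional_tensorElem (ρ φ : StrongDual ℂ toeplitz) (a b : toeplitz) :
    tensorFunctional ρ φ (tensorElem a b) = ρ a * φ b :=
  (existsUnique_tensorFunctional ρ φ).choose_spec.1 a b

/-- The comultiplication as a continuous linear map. -/
def comulL : toeplitz →L[ℂ] minTensor where
  toLinearMap := comul.toAlgHom.toLinearMap
  cont := AddMonoidHomClass.continuous_of_bound comul 1 fun x => by
    simpa using NonUnitalStarAlgHom.norm_apply_le comul x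

/-- The product `(ρ ∗ φ)(A) = (ρ ⊗ φ)(Δ(A))` on the dual space `𝒯*`. -/
def conv (ρ φ : StrongDual ℂ toeplitz) : StrongDual ℂ toeplitz :=
  (tensorFunctional ρ φ).comp comulL

/-! ### Complex measures on the circle -/

open MeasureTheory

instance : MeasurableSpace Circle := borel Circle

instance : BorelSpace Circle := ⟨rfl⟩

/-- `M(S¹)`: the complex Borel measures on the circle (all of them are regular). -/
abbrev CircleMeasure : Type := ComplexMeasure Circle

instance isFiniteMeasure_variation (μ : CircleMeasure) : IsFiniteMeasure μ.variation := by
  refine isFiniteMeasure_of_le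
    ((ComplexMeasure.re μ).totalVariation + (ComplexMeasure.im μ).totalVariation)
    (VectorMeasure.variation_le_of_forall_enorm_le fun s _ => ?_)
  have h : ‖μ s‖ ≤ ‖(μ s).re‖ + ‖(μ s).im‖ := Complex.norm_le_abs_re_add_abs_im _
  have h' : ‖μ s‖ₑ ≤ ‖(μ s).re‖ₑ + ‖(μ s).im‖ₑ := by
    simp only [← ofReal_norm]
    rw [← ENNReal.ofReal_add (norm_nonneg _) (norm_nonneg _)]
    exact ENNReal.ofReal_le_ofReal h
  exact h'.trans (add_le_add (SignedMeasure.enorm_le_totalVariation (ComplexMeasure.re μ) s)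
    (SignedMeasure.enorm_le_totalVariation (ComplexMeasure.im μ) s))

/-- The integral `∫ f dμ` of a complex function against a complex measure. -/
def cintegral (μ : CircleMeasure) (f : Circle → ℂ) : ℂ :=
  μ.integral f (ContinuousLinearMap.mul ℝ ℂ)

lemma integrable_continuousMap (μ : CircleMeasure) (f : C(Circle, ℂ)) : μ.Integrable f :=
  Integrable.of_bound f.continuous.aestronglyMeasurable ‖f‖
    (Filter.Eventually.of_forall fun x => f.norm_coe_le_norm x)

lemma cintegral_smul (μ : CircleMeasure) (c : ℂ) (f : Circle → ℂ) :
    cintegral μ (c • f) = c * cintegral μ f := by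
  refine setToFun_smul (𝕜 := ℂ) _ (fun c s x => ?_) c f
  change c * x * μ s = c * (x * μ s)
  ring

lemma cintegral_smul_measure (μ : CircleMeasure) (c : ℂ) (f : Circle → ℂ)
    (hf : μ.Integrable f) : cintegral (c • μ) f = c * cintegral μ f := by
  set B := ContinuousLinearMap.mul ℝ ℂ with hB
  have hv : (c • μ).variation = ‖c‖₊ • μ.variation := VectorMeasure.variation_smul
  have h1 := dominatedFinMeasAdditive_cbmApplyMeasure (c • μ) B
  have hT : DominatedFinMeasAdditive μ.variation ((c • μ).transpose B) (‖c‖ * ‖B‖) := by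
    refine ⟨fun s t hs ht _ _ hd =>
      h1.1 s t hs ht (measure_ne_top _ _) (measure_ne_top _ _) hd, fun s hs _ => ?_⟩
    refine (h1.2 s hs (measure_lt_top _ _)).trans (le_of_eq ?_)
    rw [hv, measureReal_nnreal_smul_apply, coe_nnnorm]
    ring
  have h2 (g : Circle → ℂ) (hg : μ.Integrable g) :
      cintegral (c • μ) g = setToFun μ.variation ((c • μ).transpose B) hT g := by
    refine (setToFun_congr_measure_of_integrable ‖c‖₊ ENNReal.coe_ne_top ?_ hT h1 g hg).symm
    rw [hv]
    exact le_rfl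
  rw [h2 f hf]
  refine Integrable.induction
    (P := fun g => setToFun μ.variation ((c • μ).transpose B) hT g = c * cintegral μ g)
    ?_ ?_ ?_ ?_ hf
  · intro x s hs hs'
    rw [setToFun_indicator_const _ hs hs'.ne]
    have : cintegral μ (s.indicator fun _ => x) = x * μ s :=
      setToFun_indicator_const _ hs hs'.ne x
    rw [this]
    change x * (c * μ s) = c * (x * μ s)
    ring
  · intro g g' _ hg hg' h h'
    rw [setToFun_add hT hg hg', h, h', ← mul_add]
    congr 1
    exact (VectorMeasure.integral_fun_add hg hg').symm
  · exact isClosed_eq (continuous_setToFun hT)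
      (continuous_const.mul VectorMeasure.continuous_integral)
  · intro g g' hgg' _ h
    rw [← setToFun_congr_ae hT hgg', h]
    congr 1
    exact setToFun_congr_ae _ hgg'

/-- The bounded functional `f ↦ ∫ f dμ` on `C(S¹)`, depending linearly on `μ ∈ M(S¹)`. -/
def integralFunctional : CircleMeasure →ₗ[ℂ] StrongDual ℂ C(Circle, ℂ) where
  toFun μ := LinearMap.mkContinuous
    { toFun := fun f => cintegral μ f
      map_add' := fun f g => VectorMeasure.integral_fun_add (integrable_continuousMap μ f)
        (integrable_continuousMap μ g)
      map_smul' := fun c f => cintegral_smul μ c f }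
    (‖ContinuousLinearMap.mul ℝ ℂ‖ * μ.variation.real Set.univ) fun f => by
      refine (VectorMeasure.norm_integral_le_of_norm_le_const (C := ‖f‖)
        (Filter.Eventually.of_forall fun x => f.norm_coe_le_norm x)).trans (le_of_eq ?_)
      ring
  map_add' μ ν := by
    ext f
    exact VectorMeasure.integral_add_vectorMeasure (integrable_continuousMap μ f)
      (integrable_continuousMap ν f)
  map_smul' c μ := by
    ext f
    exact cintegral_smul_measure μ c f (integrable_continuousMap μ f)

lemma integralFunctional_apply (μ : CircleMeasure) (f : C(Circle, ℂ)) :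
    integralFunctional μ f = cintegral μ f := rfl

/-- The convolution of complex measures: the image of the product measure under multiplication
in the circle. -/
def measureConv (μ ν : CircleMeasure) : CircleMeasure :=
  (μ.prod ν (ContinuousLinearMap.mul ℝ ℂ)).map fun p : Circle × Circle => p.1 * p.2

/-- The normalized Haar measure on the circle, as a complex measure. -/
def haarCircle : CircleMeasure :=
  ((Measure.haarMeasure (⊤ : TopologicalSpace.PositiveCompacts Circle)).toSignedMeasure).toComplexMeasure 0

/-- The symbol map `γ : 𝒯 → C(S¹)`, the unital `*`-homomorphism with `γ(T) = e^{-iθ}`. -/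
def symbol : toeplitz →⋆ₐ[ℂ] C(Circle, ℂ) := existsUnique_symbol.choose

lemma symbol_shift : symbol toeplitzShift = star circleVar := existsUnique_symbol.choose_spec.1

set_option synthInstance.maxHeartbeats 200000 in
/-- The symbol of `T_{n,m}` is `e^{ikθ}` with `k = m - n`. -/
lemma symbol_monomial (n m : ℕ) (z : Circle) :
    symbol (monomial n m) z = (z : ℂ) ^ ((m : ℤ) - n) := by
  have hz := z.coe_ne_zero
  rw [monomial, map_mul, map_pow, map_pow, map_star, symbol_shift, star_star]
  have : (starRingEnd ℂ) (z : ℂ) = (z : ℂ)⁻¹ := by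
    rw [← Circle.coe_inv_eq_conj, Circle.coe_inv]
  simp only [ContinuousMap.mul_apply, ContinuousMap.pow_apply, ContinuousMap.star_apply,
    circleVar_apply, RCLike.star_def, this, zpow_sub₀ hz, zpow_natCast, inv_pow]
  rw [div_eq_mul_inv, mul_comm]

/-- The symbol map as a continuous linear map. -/
def symbolL : toeplitz →L[ℂ] C(Circle, ℂ) where
  toLinearMap := symbol.toAlgHom.toLinearMap
  cont := AddMonoidHomClass.continuous_of_bound symbol 1 fun x => by
    simpa using NonUnitalStarAlgHom.norm_apply_le symbol x

/-- The map `M(S¹) → 𝒯*` sending `μ` to the functional `A ↦ ∫ γ(A) dμ`. -/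
def measureFunctional : CircleMeasure →ₗ[ℂ] StrongDual ℂ toeplitz where
  toFun μ := (integralFunctional μ).comp symbolL
  map_add' μ ν := by ext; simp
  map_smul' c μ := by ext; simp

lemma measureFunctional_apply (μ : CircleMeasure) (A : toeplitz) :
    measureFunctional μ A = cintegral μ (symbol A) := rfl

/-! ### Haar functionals -/

/-- `𝒦^⊥`: the functionals in `𝒯*` that vanish on the compact operators. -/
def compactAnnihilator : Submodule ℂ (StrongDual ℂ toeplitz) where
  carrier := {ρ | ∀ A : toeplitz, IsCompactOperator (A : Ell2 →L[ℂ] Ell2) → ρ A = 0}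
  add_mem' {ρ φ} hρ hφ A hA := by
    rw [add_apply, hρ A hA, hφ A hA, add_zero]
  zero_mem' _ _ := rfl
  smul_mem' c ρ hρ A hA := by
    rw [smul_apply, hρ A hA, smul_zero]

/-- States of the Toeplitz algebra: positive functionals with value `1` at the identity. -/
def IsState (ρ : StrongDual ℂ toeplitz) : Prop :=
  (∀ A : toeplitz, 0 ≤ ρ (star A * A)) ∧ ρ 1 = 1

/-- A Haar functional in a space `V` of functionals on `𝒯` (here `V` is `𝒯*` or `𝒦^⊥`): a state
`h ∈ V` such that for every `ρ ∈ V` there is a scalar `c` with `h ∗ ρ = ρ ∗ h = c h`. -/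
structure IsHaarFunctional (V : Submodule ℂ (StrongDual ℂ toeplitz))
    (h : StrongDual ℂ toeplitz) : Prop where
  mem : h ∈ V
  isState : IsState h
  invariant : ∀ ρ ∈ V, ∃ c : ℂ, conv h ρ = c • h ∧ conv ρ h = c • h

end

end ToeplitzQS

/-! Everything is read off the monomials `T_{n,m}`. Since `T* T = 1`, products of monomials are
monomials, so their span is dense and a bounded functional is determined by its array of values
`ρ(T_{n,m})` (`dual_ext`). Since `Δ(T_{n,m}) = T_{n,m} ⊗ T_{n,m}`, the product on the dual is
entrywise multiplication of these arrays (`conv_monomial`); in particular it is commutative.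

Measures: a compact element of the Toeplitz algebra has zero symbol, because `T*ⁿ K → 0` in norm
while `γ(T*)` is unimodular. Conversely, let `ρ` vanish on compacts. As `1 - T_{n,n}` is compact,
`ρ(T_{n,m})` depends only on `n - m`. Compressing the functional calculus of the bilateral shift
gives a bounded linear map `σ` with `σ(γ(T^k)) = T^k` and `σ(γ(T*^k)) = T*^k`. Comparing monomials
shows that an extension of `ρ` composed with `σ ∘ γ` equals `ρ`, so `ρ` factors through `γ`
(`exists_eq_comp_symbolL`), and the Riesz theorem on the circle supplies a measure. Uniqueness of
the measure combines density of the range of `γ` with density of continuous functions in `L¹(|μ|)`.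
Multiplicativity holds because the symbols of monomials are characters of the circle.

Haar functionals: if `h` is Haar and `ρ(1) = 1`, evaluation at `1` gives `h * ρ = h`, so `h`
vanishes at each monomial where `ρ` does (`IsHaarFunctional.monomial_eq_zero`). In the full dual the
vacuum state, with array supported at `(0,0)`, forces uniqueness. In the annihilator Lebesgue
measure, with array `δ_{n,m}`, does the same, since there the diagonal entries all equal `h(1) = 1`.
The two differ at `T T*`. -/

namespace ToeplitzQS

noncomputable section

open MeasureTheory

/-! ### Reduction of complex measures to finite positive measures -/

section complexMeasure

variable {X : Type*} [MeasurableSpace X]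

/-- A finite positive measure, viewed as a complex measure. -/
def ofMeasure (m : Measure X) [IsFiniteMeasure m] : ComplexMeasure X :=
  m.toSignedMeasure.toComplexMeasure 0

lemma ofMeasure_apply (m : Measure X) [IsFiniteMeasure m] {s : Set X} (hs : MeasurableSet s) :
    ofMeasure m s = (m.real s : ℂ) := by
  rw [ofMeasure, SignedMeasure.toComplexMeasure_apply,
    Measure.toSignedMeasure_apply_measurable hs]
  rfl

/-- The integral against a vector measure is built over its variation, so this identity is what
makes it comparable with the Bochner integral. -/
lemma variation_ofMeasure (m : Measure X) [IsFiniteMeasure m] : (ofMeasure m).variation = m := by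
  have h (s : Set X) (hs : MeasurableSet s) : ‖ofMeasure m s‖ₑ = m s := by
    rw [ofMeasure_apply m hs, ← ofReal_norm, Complex.norm_real, Real.norm_of_nonneg (by positivity),
      measureReal_def, ENNReal.ofReal_toReal (measure_ne_top _ _)]
  refine le_antisymm (VectorMeasure.variation_le_of_forall_enorm_le fun s hs => (h s hs).le)
    (Measure.le_iff.2 fun s hs => ?_)
  rw [← h s hs]
  exact VectorMeasure.enorm_measure_le_variation _ _

lemma integral_ofMeasure (m : Measure X) [IsFiniteMeasure m] (f : X → ℂ) :
    (ofMeasure m).integral f (ContinuousLinearMap.mul ℝ ℂ) = ∫ x, f x ∂m := by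
  rw [VectorMeasure.integral_eq_setToFun, MeasureTheory.integral_eq_setToFun]
  simp only [variation_ofMeasure]
  refine setToFun_congr_left' _ _ (fun s hs h's => ?_) _
  ext x
  change x * ofMeasure m s = _
  rw [ofMeasure_apply m hs, weightedSMul_apply, mul_comm]
  rfl

/-- Every complex measure is a combination of finite positive measures. -/
lemma complexMeasure_induction {P : ComplexMeasure X → Prop}
    (pos : ∀ (m : Measure X) [IsFiniteMeasure m], P (ofMeasure m))
    (add : ∀ μ ν, P μ → P ν → P (μ + ν)) (smul : ∀ (c : ℂ) μ, P μ → P (c • μ))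
    (μ : ComplexMeasure X) : P μ := by
  -- Jordan decompositions of the real and imaginary parts; differences are written with the scalar
  -- `-1` because the hypotheses on `P` cover only sums and scalar multiples.
  have key : μ = (ofMeasure (ComplexMeasure.re μ).toJordanDecomposition.posPart +
      (-1 : ℂ) • ofMeasure (ComplexMeasure.re μ).toJordanDecomposition.negPart) +
      Complex.I • (ofMeasure (ComplexMeasure.im μ).toJordanDecomposition.posPart +
      (-1 : ℂ) • ofMeasure (ComplexMeasure.im μ).toJordanDecomposition.negPart) := by
    refine VectorMeasure.ext fun s hs => ?_
    have h1 := (ComplexMeasure.re μ).apply_eq_posPart_real_sub_negPart_real hs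
    have h2 := (ComplexMeasure.im μ).apply_eq_posPart_real_sub_negPart_real hs
    have e1 : ComplexMeasure.re μ s = (μ s).re := rfl
    have e2 : ComplexMeasure.im μ s = (μ s).im := rfl
    rw [e1] at h1
    rw [e2] at h2
    simp only [add_apply, smul_apply, ofMeasure_apply _ hs, smul_eq_mul]
    apply Complex.ext
    · simp [h1, sub_eq_add_neg]
    · simp [h2, sub_eq_add_neg]
  rw [key]
  exact add _ _ (add _ _ (pos _) (smul _ _ (pos _)))
    (smul _ _ (add _ _ (pos _) (smul _ _ (pos _))))

end complexMeasure

lemma cintegral_ofMeasure (m : Measure Circle) [IsFiniteMeasure m] (f : Circle → ℂ) :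
    cintegral (ofMeasure m) f = ∫ x, f x ∂m := integral_ofMeasure m f

/-- A complex measure is determined by the integrals of continuous functions. -/
lemma integralFunctional_injective : Function.Injective integralFunctional := by
  rw [injective_iff_map_eq_zero]
  intro μ hμ
  have hc : Continuous fun f : Circle →₁[μ.variation] ℂ => cintegral μ f :=
    VectorMeasure.continuous_integral
  have hd : DenseRange (ContinuousMap.toLp 1 μ.variation ℂ : C(Circle, ℂ) →L[ℂ] _) :=
    ContinuousMap.toLp_denseRange _ _ _ ENNReal.one_ne_top
  have h0 : (fun f : Circle →₁[μ.variation] ℂ => cintegral μ f) = fun _ => 0 := by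
    -- Integration is continuous on `L¹(|μ|)` and vanishes on the dense set of continuous functions.
    -- It therefore vanishes on indicators, which lie in `L¹` because the variation is finite.
    refine hd.equalizer hc continuous_const ?_
    ext f
    refine Eq.trans (VectorMeasure.integral_congr_ae ?_) (DFunLike.congr_fun hμ f)
    exact ContinuousMap.coeFn_toLp _ f
  refine VectorMeasure.ext fun s hs => ?_
  have h1 := congrFun h0 (indicatorConstLp 1 hs (measure_ne_top _ _) (1 : ℂ))
  have h2 : cintegral μ (indicatorConstLp 1 hs (measure_ne_top μ.variation s) (1 : ℂ)) =
      cintegral μ (s.indicator fun _ => 1) := VectorMeasure.integral_congr_ae indicatorConstLp_coeFn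
  have h3 : cintegral μ (s.indicator fun _ => (1 : ℂ)) = 1 * μ s :=
    setToFun_indicator_const _ hs (measure_ne_top _ _) 1
  simp only [h2, h3, one_mul] at h1
  exact h1

/-! ### Convolution of measures and characters -/

lemma measureConv_apply (μ ν : CircleMeasure) {s : Set Circle} (hs : MeasurableSet s) :
    measureConv μ ν s = μ.prod ν (ContinuousLinearMap.mul ℝ ℂ)
      ((fun p : Circle × Circle => p.1 * p.2) ⁻¹' s) :=
  VectorMeasure.map_apply _ (by fun_prop) hs

lemma measureConv_add_left (μ μ' ν : CircleMeasure) :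
    measureConv (μ + μ') ν = measureConv μ ν + measureConv μ' ν := by
  have : (μ + μ').prod ν (ContinuousLinearMap.mul ℝ ℂ) =
      μ.prod ν (ContinuousLinearMap.mul ℝ ℂ) + μ'.prod ν (ContinuousLinearMap.mul ℝ ℂ) :=
    VectorMeasure.prod_eq_of_forall_apply_prod fun s t _ _ => by simp
  refine VectorMeasure.ext fun s hs => ?_
  rw [add_apply, measureConv_apply _ _ hs, measureConv_apply _ _ hs, measureConv_apply _ _ hs,
    this, add_apply]

lemma measureConv_smul_left (c : ℂ) (μ ν : CircleMeasure) :
    measureConv (c • μ) ν = c • measureConv μ ν := by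
  have : (c • μ).prod ν (ContinuousLinearMap.mul ℝ ℂ) =
      c • μ.prod ν (ContinuousLinearMap.mul ℝ ℂ) :=
    VectorMeasure.prod_eq_of_forall_apply_prod fun s t _ _ => by simp [mul_assoc]
  refine VectorMeasure.ext fun s hs => ?_
  rw [smul_apply, measureConv_apply _ _ hs, measureConv_apply _ _ hs, this, smul_apply]

/-- Product measures are determined on rectangles, so swapping factors only costs commutativity of
the scalars; the circle is abelian as well. This transfers linearity from the left variable to the
right one. -/
lemma measureConv_comm (μ ν : CircleMeasure) : measureConv μ ν = measureConv ν μ := by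
  have hsw : Measurable (Prod.swap : Circle × Circle → Circle × Circle) := measurable_swap
  have : μ.prod ν (ContinuousLinearMap.mul ℝ ℂ) =
      (ν.prod μ (ContinuousLinearMap.mul ℝ ℂ)).map Prod.swap :=
    VectorMeasure.prod_eq_of_forall_apply_prod fun s t hs ht => by
      rw [VectorMeasure.map_apply _ hsw (hs.prod ht), Set.preimage_swap_prod,
        VectorMeasure.prod_apply]
      simp [mul_comm]
  refine VectorMeasure.ext fun s hs => ?_
  rw [measureConv_apply _ _ hs, measureConv_apply _ _ hs, this,
    VectorMeasure.map_apply _ hsw (measurable_mul hs)]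
  congr 1
  ext p
  simp [mul_comm]

lemma measureConv_ofMeasure (m m' : Measure Circle) [IsFiniteMeasure m] [IsFiniteMeasure m'] :
    measureConv (ofMeasure m) (ofMeasure m') = ofMeasure ((m.prod m').map fun p => p.1 * p.2) := by
  have : (ofMeasure m).prod (ofMeasure m') (ContinuousLinearMap.mul ℝ ℂ) =
      ofMeasure (m.prod m') :=
    VectorMeasure.prod_eq_of_forall_apply_prod fun s t hs ht => by
      rw [ofMeasure_apply _ (hs.prod ht), ofMeasure_apply _ hs, ofMeasure_apply _ ht,
        measureReal_prod_prod]
      simp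
  refine VectorMeasure.ext fun s hs => ?_
  rw [measureConv_apply _ _ hs, this, ofMeasure_apply _ (measurable_mul hs), ofMeasure_apply _ hs,
    map_measureReal_apply (by fun_prop) hs]

/-- Convolution of measures multiplies the integrals of a multiplicative function. -/
lemma integralFunctional_measureConv (χ : C(Circle, ℂ)) (hχ : ∀ z w, χ (z * w) = χ z * χ w)
    (μ ν : CircleMeasure) : integralFunctional (measureConv μ ν) χ =
      integralFunctional μ χ * integralFunctional ν χ := by
  -- Both sides are bilinear in the two measures, so positive measures suffice, and there the claim
  -- is Fubini's theorem.
  induction μ using complexMeasure_induction with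
  | add μ μ' h h' =>
    rw [measureConv_add_left, map_add, map_add, add_apply, add_apply, h, h', add_mul]
  | smul c μ h =>
    rw [measureConv_smul_left, map_smul, map_smul, smul_apply, smul_apply, h, smul_mul_assoc]
  | pos m =>
    induction ν using complexMeasure_induction with
    | add ν ν' h h' =>
      rw [measureConv_comm, measureConv_add_left, map_add, map_add, add_apply, add_apply,
        measureConv_comm ν, measureConv_comm ν', h, h', mul_add]
    | smul c ν h =>
      rw [measureConv_comm, measureConv_smul_left, map_smul, map_smul, smul_apply, smul_apply,
        measureConv_comm ν, h, mul_smul_comm]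
    | pos m' =>
      rw [measureConv_ofMeasure]
      simp only [integralFunctional_apply, cintegral_ofMeasure]
      rw [MeasureTheory.integral_map (by fun_prop) χ.continuous.aestronglyMeasurable]
      simp only [hχ]
      exact integral_prod_mul _ _

lemma cintegral_haarCircle (f : Circle → ℂ) :
    cintegral haarCircle f =
      ∫ x, f x ∂(Measure.haarMeasure (⊤ : TopologicalSpace.PositiveCompacts Circle)) :=
  cintegral_ofMeasure _ f

/-! ### Riesz representation of bounded functionals on continuous functions -/

section riesz

open scoped NNReal Pointwise

variable {X : Type*} [TopologicalSpace X]

/-- The positive part of a bounded functional on `C(X, ℝ)`, evaluated on nonnegative functions. -/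
def posSup (Λ : StrongDual ℝ C(X, ℝ)) (f : C(X, ℝ)) : ℝ := sSup (Λ '' Set.Icc 0 f)

lemma nonempty_image_Icc (Λ : StrongDual ℝ C(X, ℝ)) {f : C(X, ℝ)} (hf : 0 ≤ f) :
    (Λ '' Set.Icc 0 f).Nonempty := ⟨_, _, Set.left_mem_Icc.2 hf, rfl⟩

/-- For `c > 0`, multiplication by `c` carries the order interval `[0, f]` onto `[0, c f]`; for `c =
0` the interval collapses to a point. -/
lemma posSup_smul (Λ : StrongDual ℝ C(X, ℝ)) (c : ℝ≥0) (f : C(X, ℝ)) :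
    posSup Λ ((c : ℝ) • f) = c * posSup Λ f := by
  rcases eq_or_ne c 0 with rfl | hc
  · simp [posSup]
  have hc' : (0 : ℝ) < c := by positivity
  have h : Λ '' Set.Icc 0 ((c : ℝ) • f) = (c : ℝ) • (Λ '' Set.Icc 0 f) := by
    ext t
    rw [Set.mem_smul_set]
    constructor
    · rintro ⟨g, hg, rfl⟩
      refine ⟨_, ⟨(c : ℝ)⁻¹ • g, ⟨fun x => ?_, fun x => ?_⟩, rfl⟩, ?_⟩
      · exact mul_nonneg (inv_nonneg.2 hc'.le) (hg.1 x)
      · exact (inv_mul_le_iff₀ hc').2 (hg.2 x)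
      · rw [← map_smul, smul_inv_smul₀ hc'.ne']
    · rintro ⟨_, ⟨g, hg, rfl⟩, rfl⟩
      refine ⟨(c : ℝ) • g, ⟨fun x => ?_, fun x => ?_⟩, map_smul _ _ _⟩
      · exact mul_nonneg hc'.le (hg.1 x)
      · exact mul_le_mul_of_nonneg_left (hg.2 x) hc'.le
  rw [posSup, h, Real.sSup_smul_of_nonneg hc'.le]
  rfl

variable [CompactSpace X]

lemma bddAbove_image_Icc (Λ : StrongDual ℝ C(X, ℝ)) (f : C(X, ℝ)) :
    BddAbove (Λ '' Set.Icc 0 f) := by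
  refine ⟨‖Λ‖ * ‖f‖, ?_⟩
  rintro _ ⟨g, hg, rfl⟩
  refine (le_abs_self _).trans ((Λ.le_opNorm g).trans ?_)
  gcongr
  refine (ContinuousMap.norm_le _ (norm_nonneg _)).2 fun x => ?_
  refine (Real.norm_of_nonneg (hg.1 x)).trans_le ?_
  exact (hg.2 x).trans ((le_abs_self _).trans (f.norm_coe_le_norm x))

lemma posSup_nonneg (Λ : StrongDual ℝ C(X, ℝ)) {f : C(X, ℝ)} (hf : 0 ≤ f) : 0 ≤ posSup Λ f :=
  le_csSup (bddAbove_image_Icc Λ f) ⟨0, Set.left_mem_Icc.2 hf, map_zero Λ⟩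

lemma le_posSup (Λ : StrongDual ℝ C(X, ℝ)) {f : C(X, ℝ)} (hf : 0 ≤ f) : Λ f ≤ posSup Λ f :=
  le_csSup (bddAbove_image_Icc Λ f) ⟨f, Set.right_mem_Icc.2 hf, rfl⟩

/-- This is the Riesz decomposition property: `k` in `[0, f + g]` splits as `k ⊓ f` plus a remainder
in `[0, g]`. Hence the interval is a Minkowski sum, and suprema add. -/
lemma posSup_add (Λ : StrongDual ℝ C(X, ℝ)) {f g : C(X, ℝ)} (hf : 0 ≤ f) (hg : 0 ≤ g) :
    posSup Λ (f + g) = posSup Λ f + posSup Λ g := by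
  have h : Set.Icc 0 (f + g) = Set.Icc 0 f + Set.Icc 0 g := by
    ext k
    rw [Set.mem_add]
    constructor
    · rintro ⟨h1, h2⟩
      refine ⟨k ⊓ f, ⟨le_inf h1 hf, inf_le_right⟩, k - k ⊓ f, ⟨sub_nonneg.2 inf_le_left, ?_⟩,
        add_sub_cancel _ _⟩
      rw [sub_le_iff_le_add']
      rw [inf_add]
      exact le_inf (le_add_of_nonneg_right hg) h2
    · rintro ⟨a, ha, b, hb, rfl⟩
      exact ⟨add_nonneg ha.1 hb.1, add_le_add ha.2 hb.2⟩
  rw [posSup, h, Set.image_add, csSup_add (nonempty_image_Icc Λ hf) (bddAbove_image_Icc Λ f)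
    (nonempty_image_Icc Λ hg) (bddAbove_image_Icc Λ g)]
  rfl

variable [T2Space X] [MeasurableSpace X] [BorelSpace X]

/-- The Riesz representation theorem for an additive, homogeneous and nonnegative function on the
cone of nonnegative continuous functions. -/
lemma exists_measure_of_cone (q : C(X, ℝ) → ℝ) (hq : ∀ f, 0 ≤ f → 0 ≤ q f)
    (hadd : ∀ f g, 0 ≤ f → 0 ≤ g → q (f + g) = q f + q g)
    (hsmul : ∀ (c : ℝ≥0) f, 0 ≤ f → q ((c : ℝ) • f) = c * q f) :
    ∃ m : Measure X, IsFiniteMeasure m ∧ ∀ f : C(X, ℝ), 0 ≤ f → ∫ x, f x ∂m = q f := by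
  let j (f : CompactlySupportedContinuousMap X ℝ≥0) : C(X, ℝ) := ⟨fun x => (f x : ℝ), by fun_prop⟩
  have hj (f : CompactlySupportedContinuousMap X ℝ≥0) : 0 ≤ j f := fun x => (f x).2
  let Λ : CompactlySupportedContinuousMap X ℝ≥0 →ₗ[ℝ≥0] ℝ≥0 :=
    { toFun := fun f => ⟨q (j f), hq _ (hj f)⟩
      map_add' := fun f g => NNReal.eq (hadd (j f) (j g) (hj f) (hj g))
      map_smul' := fun c f => NNReal.eq (hsmul c (j f) (hj f)) }
  have hfin : IsFiniteMeasure (NNRealRMK.rieszMeasure Λ) := by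
    infer_instance
  refine ⟨NNRealRMK.rieszMeasure Λ, hfin, fun f hf => ?_⟩
  let f' : CompactlySupportedContinuousMap X ℝ≥0 :=
    ⟨⟨fun x => (f x).toNNReal, by fun_prop⟩, HasCompactSupport.of_compactSpace _⟩
  have h1 (x : X) : ((f' x : ℝ≥0) : ℝ) = f x := Real.coe_toNNReal _ (hf x)
  have h2 : j f' = f := ContinuousMap.ext h1
  have h3 := NNRealRMK.integral_rieszMeasure Λ f'
  simp only [h1] at h3
  rw [h3]
  change q (j f') = _
  rw [h2]

/-- Every bounded functional on `C(X, ℝ)` is a difference of two finite measures. -/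
lemma exists_measures_of_real_functional (Λ : StrongDual ℝ C(X, ℝ)) :
    ∃ m m' : Measure X, IsFiniteMeasure m ∧ IsFiniteMeasure m' ∧
      ∀ f : C(X, ℝ), Λ f = ∫ x, f x ∂m - ∫ x, f x ∂m' := by
  obtain ⟨m, hm, h⟩ := exists_measure_of_cone (posSup Λ) (fun f => posSup_nonneg Λ)
    (fun f g => posSup_add Λ) (fun c f _ => posSup_smul Λ c f)
  -- The negative part of `Λ` is `posSup Λ - Λ`, nonnegative on the cone because `f` itself competes
  -- in the supremum.
  obtain ⟨m', hm', h'⟩ := exists_measure_of_cone (fun f => posSup Λ f - Λ f)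
    (fun f hf => sub_nonneg.2 (le_posSup Λ hf))
    (fun f g hf hg => by simp only [posSup_add Λ hf hg, map_add]; ring)
    (fun c f _ => by simp only [posSup_smul Λ c f, map_smul, smul_eq_mul]; ring)
  have hpos (f : C(X, ℝ)) (hf : 0 ≤ f) : Λ f = ∫ x, f x ∂m - ∫ x, f x ∂m' := by
    rw [h f hf, h' f hf]
    ring
  refine ⟨m, m', hm, hm', fun f => ?_⟩
  have hint (n : Measure X) [IsFiniteMeasure n] (g : C(X, ℝ)) : Integrable g n :=
    g.continuous.integrable_of_hasCompactSupport (HasCompactSupport.of_compactSpace _)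
  -- Write `f` as its positive part minus its negative part, so that the formula on the cone extends
  -- by linearity.
  have hf : f = f ⊔ 0 - (f ⊔ 0 - f) := (sub_sub_cancel _ _).symm
  have h1 : (0 : C(X, ℝ)) ≤ f ⊔ 0 := le_sup_right
  have h2 : 0 ≤ f ⊔ 0 - f := sub_nonneg.2 le_sup_left
  generalize f ⊔ 0 = a at *
  generalize a - f = b at *
  subst hf
  rw [map_sub, hpos a h1, hpos b h2]
  simp only [ContinuousMap.sub_apply]
  rw [integral_sub (hint m a) (hint m b), integral_sub (hint m' a) (hint m' b)]
  ring

end riesz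

/-- The Riesz representation theorem for the circle. -/
lemma integralFunctional_surjective : Function.Surjective integralFunctional := by
  intro Φ
  let J : C(Circle, ℝ) →L[ℝ] C(Circle, ℂ) := Complex.ofRealCLM.compLeftContinuous ℝ Circle
  let Φ' : C(Circle, ℂ) →L[ℝ] ℂ := Φ.restrictScalars ℝ
  obtain ⟨m₁, m₂, _, _, h⟩ := exists_measures_of_real_functional (Complex.reCLM ∘L Φ' ∘L J)
  obtain ⟨m₃, m₄, _, _, h'⟩ := exists_measures_of_real_functional (Complex.imCLM ∘L Φ' ∘L J)
  refine ⟨(ofMeasure m₁ - ofMeasure m₂) + Complex.I • (ofMeasure m₃ - ofMeasure m₄), ?_⟩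
  set μ := (ofMeasure m₁ - ofMeasure m₂) + Complex.I • (ofMeasure m₃ - ofMeasure m₄) with hμ
  -- Real-valued functions suffice, by complex linearity of both functionals.
  have hJ (f : C(Circle, ℝ)) : integralFunctional μ (J f) = Φ (J f) := by
    have e (n : Measure Circle) [IsFiniteMeasure n] :
        integralFunctional (ofMeasure n) (J f) = ((∫ x, f x ∂n : ℝ) : ℂ) := by
      rw [integralFunctional_apply, cintegral_ofMeasure]
      exact integral_ofReal
    simp only [hμ, map_add, map_sub, map_smul, add_apply, sub_apply, smul_apply, e, smul_eq_mul]
    rw [← Complex.ofReal_sub, ← Complex.ofReal_sub, ← h f, ← h' f, mul_comm]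
    exact Complex.re_add_im (Φ (J f))
  ext f
  let a : C(Circle, ℝ) := ⟨fun x => (f x).re, by fun_prop⟩
  let b : C(Circle, ℝ) := ⟨fun x => (f x).im, by fun_prop⟩
  have hf : f = J a + Complex.I • J b := by
    ext x
    exact (Complex.re_add_im (f x)).symm.trans (by rw [mul_comm]; rfl)
  rw [hf, map_add (integralFunctional μ), map_add Φ, map_smul (integralFunctional μ), map_smul Φ,
    hJ, hJ]

/-! ### The monomials `T_{n,m}`: density and diagonal comultiplication -/

lemma star_toeplitzShift_mul : star toeplitzShift * toeplitzShift = 1 :=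
  Subtype.ext star_shift_mul_shift

lemma star_pow_mul_pow (k : ℕ) : star toeplitzShift ^ k * toeplitzShift ^ k = 1 := by
  induction k with
  | zero => simp
  | succ k ih =>
    rw [pow_succ, pow_succ', mul_assoc, ← mul_assoc (star toeplitzShift), star_toeplitzShift_mul,
      one_mul, ih]

lemma monomial_zero_zero : monomial 0 0 = 1 := by simp [monomial]

lemma star_monomial (n m : ℕ) : star (monomial n m) = monomial m n := by
  rw [monomial, star_mul, star_pow, star_pow, star_star, monomial]

/-- The inner factor `T*^m T^p` collapses, by `T* T = 1`, to a power of `T` or of `T*` according to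
which exponent is larger. -/
lemma monomial_mul_monomial (n m p q : ℕ) :
    ∃ n' m', monomial n m * monomial p q = monomial n' m' := by
  simp only [monomial]
  rcases le_total m p with h | h
  · obtain ⟨k, rfl⟩ := Nat.exists_eq_add_of_le h
    refine ⟨n + k, q, ?_⟩
    calc _ = toeplitzShift ^ n * (star toeplitzShift ^ m * toeplitzShift ^ m) *
          toeplitzShift ^ k * star toeplitzShift ^ q := by rw [pow_add]; noncomm_ring
      _ = _ := by rw [star_pow_mul_pow, mul_one, pow_add]
  · obtain ⟨k, rfl⟩ := Nat.exists_eq_add_of_le' h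
    refine ⟨n, k + q, ?_⟩
    calc _ = toeplitzShift ^ n * star toeplitzShift ^ k *
          (star toeplitzShift ^ p * toeplitzShift ^ p) * star toeplitzShift ^ q := by
          rw [pow_add]; noncomm_ring
      _ = _ := by rw [star_pow_mul_pow, mul_one, mul_assoc, pow_add]

/-- A property of elements of the Toeplitz algebra that defines a closed subspace holds everywhere
as soon as it holds for the monomials. -/
lemma eq_top_of_monomial_mem (S : Submodule ℂ toeplitz) (hS : IsClosed (S : Set toeplitz))
    (h : ∀ n m, monomial n m ∈ S) : S = ⊤ := by
  let M : Submonoid toeplitz :=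
    { carrier := Set.range fun p : ℕ × ℕ => monomial p.1 p.2
      mul_mem' := by
        rintro _ _ ⟨p, rfl⟩ ⟨q, rfl⟩
        obtain ⟨n, m, h⟩ := monomial_mul_monomial p.1 p.2 q.1 q.2
        exact ⟨(n, m), h.symm⟩
      one_mem' := ⟨(0, 0), monomial_zero_zero⟩ }
  -- The algebra generated by the shift is formed inside the bounded operators, so the monoid of
  -- monomials is moved there; the algebra then lies in its linear span.
  let N : Submonoid (Ell2 →L[ℂ] Ell2) := M.map toeplitz.subtype
  have hN : Submonoid.closure ({shift} ∪ star {shift} : Set (Ell2 →L[ℂ] Ell2)) ≤ N := by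
    refine Submonoid.closure_le.2 ?_
    rintro _ (rfl | hx)
    · exact ⟨monomial 1 0, ⟨(1, 0), rfl⟩, by simp [monomial, toeplitzShift]⟩
    · refine ⟨monomial 0 1, ⟨(0, 1), rfl⟩, ?_⟩
      rw [Set.star_singleton] at hx
      rw [Set.mem_singleton_iff.1 hx]
      simp [monomial, toeplitzShift]
  have hspan : Submodule.span ℂ (N : Set (Ell2 →L[ℂ] Ell2)) ≤
      S.map toeplitz.toSubalgebra.toSubmodule.subtype := by
    refine Submodule.span_le.2 ?_
    rintro _ ⟨_, ⟨p, rfl⟩, rfl⟩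
    exact ⟨_, h p.1 p.2, rfl⟩
  have hadj (x : Ell2 →L[ℂ] Ell2) (hx : x ∈ StarAlgebra.adjoin ℂ {shift}) :
      x ∈ Submodule.span ℂ (N : Set (Ell2 →L[ℂ] Ell2)) := by
    have h1 : x ∈ Subalgebra.toSubmodule (Algebra.adjoin ℂ ({shift} ∪ star {shift})) := by
      rw [← StarAlgebra.adjoin_toSubalgebra]
      exact hx
    rw [Algebra.adjoin_eq_span] at h1
    exact Submodule.span_mono hN h1
  refine Submodule.eq_top_iff'.2 fun x => ?_
  have hx : (x : Ell2 →L[ℂ] Ell2) ∈ closure ((fun a : toeplitz => (a : Ell2 →L[ℂ] Ell2)) '' S) := by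
    have h1 : (x : Ell2 →L[ℂ] Ell2) ∈
        closure (StarAlgebra.adjoin ℂ {shift} : Set (Ell2 →L[ℂ] Ell2)) := x.2
    refine closure_mono ?_ h1
    intro y hy
    obtain ⟨a, ha, rfl⟩ := hspan (hadj y hy)
    exact ⟨a, ha, rfl⟩
  have h2 : x ∈ closure (S : Set toeplitz) := closure_subtype.2 hx
  rwa [hS.closure_eq] at h2

/-- Bounded functionals on the Toeplitz algebra are determined by their values at the monomials. -/
lemma dual_ext {ρ φ : StrongDual ℂ toeplitz}
    (h : ∀ n m, ρ (monomial n m) = φ (monomial n m)) : ρ = φ := by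
  have := eq_top_of_monomial_mem (LinearMap.eqLocus ρ.toLinearMap φ.toLinearMap)
    (isClosed_eq ρ.continuous φ.continuous) h
  ext A
  exact (this.ge (Submodule.mem_top (x := A)) :)

lemma tensorElem_mul (a a' b b' : toeplitz) :
    tensorElem a b * tensorElem a' b' = tensorElem (a * a') (b * b') :=
  Subtype.ext (opTensor_mul _ _ _ _)

lemma tensorElem_one : tensorElem 1 1 = 1 := Subtype.ext opTensor_one_one

lemma tensorElem_pow (a b : toeplitz) (k : ℕ) :
    tensorElem a b ^ k = tensorElem (a ^ k) (b ^ k) := by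
  induction k with
  | zero => simp [tensorElem_one]
  | succ k ih => rw [pow_succ, ih, tensorElem_mul, pow_succ, pow_succ]

lemma star_tensorElem (a b : toeplitz) : star (tensorElem a b) = tensorElem (star a) (star b) :=
  Subtype.ext (star_opTensor _ _)

/-- Monomials are group-like because `T` is and elementary tensors multiply and take adjoints
factorwise. -/
lemma comul_monomial (n m : ℕ) :
    comul (monomial n m) = tensorElem (monomial n m) (monomial n m) := by
  rw [monomial, map_mul, map_pow, map_pow, map_star, comul_shift, star_tensorElem, tensorElem_pow,
    tensorElem_pow, tensorElem_mul]

/-- The product on the dual is pointwise multiplication on monomials. -/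
lemma conv_monomial (ρ φ : StrongDual ℂ toeplitz) (n m : ℕ) :
    conv ρ φ (monomial n m) = ρ (monomial n m) * φ (monomial n m) := by
  change tensorFunctional ρ φ (comul (monomial n m)) = _
  rw [comul_monomial, tensorFunctional_tensorElem]

/-! ### Compact operators in the Toeplitz algebra -/

lemma star_shift_stdBasis_zero : star shift (stdBasis 0) = 0 := by
  refine ext_inner_left ℂ fun v => ?_
  rw [ContinuousLinearMap.star_eq_adjoint, ContinuousLinearMap.adjoint_inner_right,
    inner_zero_right, stdBasis, lp.inner_single_right]
  change inner ℂ (shiftFun v 0) 1 = _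
  simp [shiftFun]

lemma star_shift_stdBasis_succ (n : ℕ) : star shift (stdBasis (n + 1)) = stdBasis n := by
  rw [← shift_stdBasis]
  exact DFunLike.congr_fun star_shift_mul_shift (stdBasis n)

/-- `1 - T T*` is the rank-one projection onto `e_0`. -/
lemma isCompactOperator_one_sub_shift :
    IsCompactOperator (1 - shift * star shift : Ell2 →L[ℂ] Ell2) := by
  have h : (1 - shift * star shift : Ell2 →L[ℂ] Ell2) =
      (ContinuousLinearMap.toSpanSingleton ℂ (stdBasis 0)) ∘L innerSL ℂ (stdBasis 0) := by
    refine ContinuousLinearMap.ext_on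
      (s := Set.range stdBasis) (Submodule.dense_iff_topologicalClosure_eq_top.2
        closure_span_stdBasis) ?_
    rintro _ ⟨n, rfl⟩
    have hi := orthonormal_iff_ite.1 orthonormal_stdBasis 0 n
    cases n with
    | zero => simp [star_shift_stdBasis_zero, orthonormal_stdBasis.1, ContinuousLinearMap.toSpanSingleton_apply]
    | succ n => simp [star_shift_stdBasis_succ, hi, shift_stdBasis,
        ContinuousLinearMap.toSpanSingleton_apply]
  rw [h]
  exact (isCompactOperator_of_locallyCompactSpace_rng (ContinuousLinearMap.toSpanSingleton ℂ
    (stdBasis 0))).comp_clm (innerSL ℂ (stdBasis 0))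

lemma isCompactOperator_one_sub_monomial (m : ℕ) :
    IsCompactOperator ((1 - monomial m m : toeplitz) : Ell2 →L[ℂ] Ell2) := by
  induction m with
  | zero =>
    rw [monomial_zero_zero, sub_self]
    exact isCompactOperator_zero
  | succ m ih =>
    -- Telescoping: the new defect is `1 - T T*` plus the previous one conjugated by the shift, and
    -- compact operators form an ideal.
    have h : ((1 - monomial (m + 1) (m + 1) : toeplitz) : Ell2 →L[ℂ] Ell2) =
        (1 - shift * star shift) +
          shift * ((1 - monomial m m : toeplitz) : Ell2 →L[ℂ] Ell2) * star shift := by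
      have : (1 - monomial (m + 1) (m + 1) : toeplitz) =
          (1 - toeplitzShift * star toeplitzShift) +
            toeplitzShift * (1 - monomial m m) * star toeplitzShift := by
        rw [monomial, monomial, pow_succ', pow_succ]
        noncomm_ring
      rw [this]
      rfl
    rw [h]
    exact isCompactOperator_one_sub_shift.add ((ih.clm_comp shift).comp_clm (star shift))

lemma norm_star_shift_apply_le (x : Ell2) : ‖star shift x‖ ≤ ‖x‖ := by
  have h : ‖(star shift : Ell2 →L[ℂ] Ell2)‖ ≤ 1 := by
    rw [ContinuousLinearMap.star_eq_adjoint, LinearIsometryEquiv.norm_map]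
    exact shiftIsometry.norm_toContinuousLinearMap_le
  simpa using (star shift).le_of_opNorm_le h x

/-- Each finite combination of basis vectors is killed by some power of `T*`; these are dense and
`T*` is a contraction. -/
lemma exists_norm_star_shift_pow_lt (x : Ell2) {ε : ℝ} (hε : 0 < ε) :
    ∃ n : ℕ, ‖(star shift ^ n : Ell2 →L[ℂ] Ell2) x‖ < ε := by
  have hfin (y : Ell2) (hy : y ∈ Submodule.span ℂ (Set.range stdBasis)) :
      ∃ N : ℕ, ∀ n ≥ N, (star shift ^ n : Ell2 →L[ℂ] Ell2) y = 0 := by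
    induction hy using Submodule.span_induction with
    | mem y hy =>
      obtain ⟨k, rfl⟩ := hy
      refine ⟨k + 1, fun n hn => ?_⟩
      induction k generalizing n with
      | zero =>
        obtain ⟨n, rfl⟩ := Nat.exists_eq_add_of_le' hn
        rw [zero_add, pow_succ, mul_apply_eq_comp, star_shift_stdBasis_zero, map_zero]
      | succ k ih =>
        obtain ⟨n, rfl⟩ := Nat.exists_eq_add_of_le' (Nat.le_of_succ_le hn)
        rw [← add_assoc, pow_succ, mul_apply_eq_comp, star_shift_stdBasis_succ, ih _ (by omega)]
    | zero => exact ⟨0, fun n _ => map_zero _⟩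
    | add y y' _ _ h h' =>
      obtain ⟨N, hN⟩ := h
      obtain ⟨N', hN'⟩ := h'
      refine ⟨max N N', fun n hn => ?_⟩
      rw [map_add, hN n (le_of_max_le_left hn), hN' n (le_of_max_le_right hn), add_zero]
    | smul c y _ h =>
      obtain ⟨N, hN⟩ := h
      exact ⟨N, fun n hn => by rw [map_smul, hN n hn, smul_zero]⟩
  have hx : x ∈ closure (Submodule.span ℂ (Set.range stdBasis) : Set Ell2) :=
    closure_span_stdBasis.ge (Submodule.mem_top (x := x))
  obtain ⟨y, hy, hxy⟩ := Metric.mem_closure_iff.1 hx ε hε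
  obtain ⟨N, hN⟩ := hfin y hy
  refine ⟨N, ?_⟩
  have h1 (n : ℕ) (v : Ell2) : ‖(star shift ^ n : Ell2 →L[ℂ] Ell2) v‖ ≤ ‖v‖ := by
    induction n generalizing v with
    | zero => simp
    | succ n ih =>
      rw [pow_succ, mul_apply_eq_comp]
      exact (ih _).trans (norm_star_shift_apply_le v)
  have h2 := h1 N (x - y)
  rw [map_sub, hN N le_rfl, sub_zero] at h2
  rw [dist_eq_norm] at hxy
  exact h2.trans_lt hxy

/-- The backward shifts converge to zero uniformly after composition with a compact operator. -/
lemma exists_norm_star_shift_pow_mul_le {K : Ell2 →L[ℂ] Ell2} (hK : IsCompactOperator K)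
    {ε : ℝ} (hε : 0 < ε) : ∃ n : ℕ, ‖star shift ^ n * K‖ ≤ ε := by
  obtain ⟨C, hC, hKC⟩ := hK.image_closedBall_subset_compact 1
  let W : ℕ → Set Ell2 := fun n => {y | ‖(star shift ^ n : Ell2 →L[ℂ] Ell2) y‖ < ε}
  -- Since `T*` is a contraction, the open sets `W n` increase, so a single one of them covers the
  -- compact set `C` containing the image of the unit ball.
  have hW : Monotone W := monotone_nat_of_le_succ fun n y hy => by
    have : (star shift ^ (n + 1) : Ell2 →L[ℂ] Ell2) y =
        star shift ((star shift ^ n : Ell2 →L[ℂ] Ell2) y) := by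
      rw [pow_succ', mul_apply_eq_comp]
    change ‖(star shift ^ (n + 1) : Ell2 →L[ℂ] Ell2) y‖ < ε
    rw [this]
    exact (norm_star_shift_apply_le _).trans_lt hy
  obtain ⟨n, hn⟩ := hC.elim_directed_cover W
    (fun n => isOpen_lt (by fun_prop) continuous_const)
    (fun y _ => Set.mem_iUnion.2 (exists_norm_star_shift_pow_lt y hε)) hW.directed_le
  refine ⟨n, ContinuousLinearMap.opNorm_le_of_unit_norm hε.le fun x hx => ?_⟩
  exact (hn (hKC ⟨x, by simp [hx], rfl⟩)).le

lemma norm_symbol_apply_le (A : toeplitz) : ‖symbol A‖ ≤ ‖A‖ := by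
  simpa using NonUnitalStarAlgHom.norm_apply_le symbol A

/-- The symbol of a compact operator vanishes. -/
lemma symbol_eq_zero_of_isCompactOperator {A : toeplitz}
    (hA : IsCompactOperator (A : Ell2 →L[ℂ] Ell2)) : symbol A = 0 := by
  ext z
  rw [ContinuousMap.zero_apply, ← norm_le_zero_iff]
  refine le_of_forall_pos_le_add fun ε hε => ?_
  -- Multiplying by `T*ⁿ` multiplies the symbol at `z` by the unimodular `zⁿ`, so the modulus there
  -- is unchanged while the operator norm drops to at most `ε`.
  obtain ⟨n, hn⟩ := exists_norm_star_shift_pow_mul_le hA hε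
  have h1 : symbol (star toeplitzShift ^ n * A) z = (z : ℂ) ^ n * symbol A z := by
    rw [map_mul, map_pow, map_star, symbol_shift, star_star]
    rfl
  have h2 : ‖symbol A z‖ = ‖symbol (star toeplitzShift ^ n * A) z‖ := by
    rw [h1, norm_mul, norm_pow, Circle.norm_coe, one_pow, one_mul]
  rw [h2, zero_add]
  refine ((symbol _).norm_coe_le_norm z).trans ?_
  exact (norm_symbol_apply_le _).trans hn

/-! ### Toeplitz operators with continuous symbol -/

/-- The continuous functional calculus of a unitary element, on the whole circle. -/
lemma exists_circle_functionalCalculus {B : Type*} [CStarAlgebra B] {u : B} (hu : u ∈ unitary B) :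
    ∃ π : C(Circle, ℂ) →⋆ₐ[ℂ] B, π circleVar = u := by
  have hn : IsStarNormal u := isStarNormal_of_mem_unitary hu
  -- The spectrum of a unitary lies in the circle; restriction of functions along this inclusion
  -- precedes the usual functional calculus.
  let r : C(spectrum ℂ u, Circle) :=
    ⟨fun x => ⟨x.1, by simpa [Submonoid.unitSphere] using spectrum.subset_circle_of_unitary hu x.2⟩,
      by fun_prop⟩
  refine ⟨(cfcHom hn).comp (ContinuousMap.compStarAlgHom' ℂ ℂ r), ?_⟩
  exact cfcHom_id hn

/-- The unilateral shift is the compression of a unitary operator to an invariant subspace. -/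
lemma exists_unitary_dilation :
    ∃ (V : Ell2 →L[ℂ] lp (fun _ : ℤ => ℂ) 2)
      (U : lp (fun _ : ℤ => ℂ) 2 →L[ℂ] lp (fun _ : ℤ => ℂ) 2),
      U ∈ unitary (lp (fun _ : ℤ => ℂ) 2 →L[ℂ] lp (fun _ : ℤ => ℂ) 2) ∧
        V.adjoint ∘L V = 1 ∧ U ∘L V = V ∘L shift := by
  classical
  let δ : ℤ → lp (fun _ : ℤ => ℂ) 2 := fun d => lp.single 2 d (1 : ℂ)
  have hδ : Orthonormal ℂ δ := by
    rw [orthonormal_iff_ite]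
    intro i j
    simp [δ, lp.inner_single_left, Pi.single_apply]
  have hδt : (Submodule.span ℂ (Set.range δ)).topologicalClosure = ⊤ := closure_span_single
  have hδ' : Orthonormal ℂ fun d => δ (d + 1) := hδ.comp _ (add_left_injective 1)
  have hδt' : (Submodule.span ℂ (Set.range fun d => δ (d + 1))).topologicalClosure = ⊤ := by
    have : (Set.range fun d => δ (d + 1)) = Set.range δ :=
      (Equiv.addRight (1 : ℤ)).surjective.range_comp δ
    rw [this, hδt]
  let b := HilbertBasis.mk hδ hδt.ge
  let b' := HilbertBasis.mk hδ' hδt'.ge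
  -- The bilateral shift, obtained by matching coordinates in the basis `δ_d` with those in the
  -- reindexed basis `δ_{d+1}`.
  let U : lp (fun _ : ℤ => ℂ) 2 ≃ₗᵢ[ℂ] lp (fun _ : ℤ => ℂ) 2 := b.repr.trans b'.repr.symm
  have hU (d : ℤ) : U (δ d) = δ (d + 1) := by
    have e1 : b d = δ d := congrFun (HilbertBasis.coe_mk hδ hδt.ge) d
    have e2 : b' d = δ (d + 1) := congrFun (HilbertBasis.coe_mk hδ' hδt'.ge) d
    rw [← e1, ← e2]
    simp [U, HilbertBasis.repr_self]
  have hN : Orthonormal ℂ fun n : ℕ => δ n := hδ.comp _ Nat.cast_injective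
  let V := hN.orthogonalFamily.linearIsometry
  have hV (n : ℕ) : V (stdBasis n) = δ n := by
    rw [stdBasis]
    refine (hN.orthogonalFamily.linearIsometry_apply_single (i := n) (1 : ℂ)).trans ?_
    simp
  refine ⟨V.toContinuousLinearMap, (U : lp (fun _ : ℤ => ℂ) 2 →L[ℂ] lp (fun _ : ℤ => ℂ) 2),
    ?_, (ContinuousLinearMap.norm_map_iff_adjoint_comp_self _).1 V.norm_map, ?_⟩
  · exact (Unitary.linearIsometryEquiv.symm U).2
  · refine ContinuousLinearMap.ext_on
      (s := Set.range stdBasis) (Submodule.dense_iff_topologicalClosure_eq_top.2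
        closure_span_stdBasis) ?_
    rintro _ ⟨n, rfl⟩
    change U (V (stdBasis n)) = V (shift (stdBasis n))
    rw [hV, hU, shift_stdBasis, hV, Nat.cast_succ]

/-- There is a bounded linear assignment of Toeplitz operators to continuous symbols. -/
lemma exists_toeplitzOperator :
    ∃ σ : C(Circle, ℂ) →L[ℂ] (Ell2 →L[ℂ] Ell2), ∀ k : ℕ,
      σ (symbol (monomial k 0)) = (monomial k 0 : Ell2 →L[ℂ] Ell2) ∧
      σ (symbol (monomial 0 k)) = (monomial 0 k : Ell2 →L[ℂ] Ell2) := by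
  obtain ⟨V, U, hU, hV, hUV⟩ := exists_unitary_dilation
  -- The calculus is taken at `U*` because `γ(T)` is the conjugate coordinate; thus `π(γ(T)) = U`.
  obtain ⟨π, hπ⟩ := exists_circle_functionalCalculus (Unitary.star_mem hU)
  let πL : C(Circle, ℂ) →L[ℂ] (lp (fun _ : ℤ => ℂ) 2 →L[ℂ] lp (fun _ : ℤ => ℂ) 2) :=
    { toLinearMap := π.toAlgHom.toLinearMap
      cont := AddMonoidHomClass.continuous_of_bound π 1 fun x => by
        simpa using NonUnitalStarAlgHom.norm_apply_le π x }
  let σ : C(Circle, ℂ) →L[ℂ] (Ell2 →L[ℂ] Ell2) :=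
    (ContinuousLinearMap.compL ℂ Ell2 (lp (fun _ : ℤ => ℂ) 2) Ell2 V.adjoint) ∘L
      ((ContinuousLinearMap.compL ℂ Ell2 (lp (fun _ : ℤ => ℂ) 2)
        (lp (fun _ : ℤ => ℂ) 2)).flip V) ∘L πL
  have hσ (f : C(Circle, ℂ)) : σ f = V.adjoint ∘L (π f ∘L V) := rfl
  -- The range of `V` is invariant under `U`, so compressing `U^k` gives exactly `T^k`. Powers of
  -- `T*` follow by taking adjoints.
  have hpow (k : ℕ) : (U ^ k) ∘L V = V ∘L (shift ^ k) := by
    induction k with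
    | zero => rfl
    | succ k ih =>
      rw [pow_succ, pow_succ']
      change (U ^ k) ∘L (U ∘L V) = (V ∘L shift) ∘L (shift ^ k)
      rw [hUV, ← hUV, ← ContinuousLinearMap.comp_assoc]
      change ((U ^ k) * U) ∘L V = _
      rw [← pow_succ, pow_succ', ContinuousLinearMap.comp_assoc, ← ih]
      rfl
  have h1 (k : ℕ) : σ (symbol (monomial k 0)) = shift ^ k := by
    have : π (symbol (monomial k 0)) = U ^ k := by
      rw [monomial, pow_zero, mul_one, map_pow, symbol_shift, map_pow, map_star, hπ, star_star]
    rw [hσ, this, hpow, ← ContinuousLinearMap.comp_assoc, hV]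
    rfl
  have hstar (f : C(Circle, ℂ)) : σ (star f) = star (σ f) := by
    rw [hσ, hσ, map_star, ContinuousLinearMap.star_eq_adjoint, ContinuousLinearMap.star_eq_adjoint,
      ContinuousLinearMap.adjoint_comp, ContinuousLinearMap.adjoint_comp,
      ContinuousLinearMap.adjoint_adjoint, ContinuousLinearMap.comp_assoc]
  refine ⟨σ, fun k => ⟨?_, ?_⟩⟩
  · rw [h1, monomial, pow_zero, mul_one]
    rfl
  · rw [← star_monomial, map_star, hstar, h1, monomial, pow_zero, mul_one]
    rfl

/-! ### Functionals vanishing on compacts are measures -/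

/-- The difference of the two monomials is `T^k` times the compact operator `1 - T_{n,n}`. With the
mirror statement below, the values of `ρ` depend only on the difference of the indices. -/
lemma apply_monomial_add_left {ρ : StrongDual ℂ toeplitz} (hρ : ρ ∈ compactAnnihilator)
    (n k : ℕ) : ρ (monomial (k + n) n) = ρ (monomial k 0) := by
  have h : monomial k 0 - monomial (k + n) n = monomial k 0 * (1 - monomial n n) := by
    simp only [monomial, pow_zero, mul_one, pow_add]
    noncomm_ring
  rw [eq_comm, ← sub_eq_zero, ← ContinuousLinearMap.map_sub, h]
  exact hρ _ ((isCompactOperator_one_sub_monomial n).clm_comp (monomial k 0 : Ell2 →L[ℂ] Ell2))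

lemma apply_monomial_add_right {ρ : StrongDual ℂ toeplitz} (hρ : ρ ∈ compactAnnihilator)
    (n k : ℕ) : ρ (monomial n (n + k)) = ρ (monomial 0 k) := by
  have h : monomial 0 k - monomial n (n + k) = (1 - monomial n n) * monomial 0 k := by
    simp only [monomial, pow_zero, one_mul, pow_add]
    noncomm_ring
  rw [eq_comm, ← sub_eq_zero, ← ContinuousLinearMap.map_sub, h]
  exact hρ _ ((isCompactOperator_one_sub_monomial n).comp_clm (monomial 0 k : Ell2 →L[ℂ] Ell2))

/-- A functional that vanishes on the compact operators factors through the symbol map. -/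
lemma exists_eq_comp_symbolL {ρ : StrongDual ℂ toeplitz} (hρ : ρ ∈ compactAnnihilator) :
    ∃ Λ : StrongDual ℂ C(Circle, ℂ), ρ = Λ.comp symbolL := by
  obtain ⟨σ, hσ⟩ := exists_toeplitzOperator
  -- Extending `ρ` to all bounded operators makes `ρ' ∘ σ` meaningful without showing that `σ` takes
  -- values in the Toeplitz algebra.
  obtain ⟨ρ', hρ', -⟩ := exists_extension_norm_eq toeplitz.toSubalgebra.toSubmodule ρ
  refine ⟨ρ' ∘L σ, dual_ext fun n m => ?_⟩
  change _ = ρ' (σ (symbol (monomial n m)))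
  rcases le_total m n with h | h
  · obtain ⟨k, rfl⟩ := Nat.exists_eq_add_of_le' h
    have : symbol (monomial (k + m) m) = symbol (monomial k 0) := by
      ext z
      rw [symbol_monomial, symbol_monomial]
      congr 1
      push_cast
      ring
    rw [this, (hσ k).1, apply_monomial_add_left hρ]
    exact (hρ' (monomial k 0)).symm
  · obtain ⟨k, rfl⟩ := Nat.exists_eq_add_of_le h
    have : symbol (monomial n (n + k)) = symbol (monomial 0 k) := by
      ext z
      rw [symbol_monomial, symbol_monomial]
      congr 1
      push_cast
      ring
    rw [this, (hσ k).2, apply_monomial_add_right hρ]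
    exact (hρ' (monomial 0 k)).symm

lemma range_measureFunctional : LinearMap.range measureFunctional = compactAnnihilator := by
  refine le_antisymm ?_ fun ρ hρ => ?_
  · rintro _ ⟨μ, rfl⟩ A hA
    change integralFunctional μ (symbol A) = 0
    rw [symbol_eq_zero_of_isCompactOperator hA, map_zero]
  · obtain ⟨Λ, rfl⟩ := exists_eq_comp_symbolL hρ
    obtain ⟨μ, rfl⟩ := integralFunctional_surjective Λ
    exact ⟨μ, rfl⟩

/-- Stone–Weierstrass: the range is a star subalgebra containing the conjugate coordinate, which
separates points. -/
lemma dense_range_symbol : Dense (Set.range symbol) := by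
  have h := ContinuousMap.starSubalgebra_topologicalClosure_eq_top_of_separatesPoints
    symbol.range fun z w hzw => by
      refine ⟨_, ⟨star circleVar, ⟨toeplitzShift, symbol_shift⟩, rfl⟩, fun h => hzw ?_⟩
      exact Circle.ext (star_injective h)
  intro f
  exact h.ge (StarSubalgebra.mem_top (x := f))

lemma measureFunctional_injective : Function.Injective measureFunctional := by
  refine (injective_iff_map_eq_zero _).2 fun μ hμ => ?_
  refine (injective_iff_map_eq_zero _).1 integralFunctional_injective μ ?_
  refine DFunLike.coe_injective (Continuous.ext_on dense_range_symbol
    (integralFunctional μ).continuous continuous_zero ?_)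
  rintro _ ⟨A, rfl⟩
  exact DFunLike.congr_fun hμ A

/-- It suffices to test monomials, whose symbols `z^(m-n)` are characters. -/
lemma measureFunctional_measureConv (μ ν : CircleMeasure) :
    measureFunctional (measureConv μ ν) = conv (measureFunctional μ) (measureFunctional ν) :=
  dual_ext fun n m => by
    rw [conv_monomial]
    refine integralFunctional_measureConv _ (fun z w => ?_) μ ν
    change symbol (monomial n m) (z * w) = symbol (monomial n m) z * symbol (monomial n m) w
    rw [symbol_monomial, symbol_monomial, symbol_monomial, Circle.coe_mul, mul_zpow]

/-! ### Haar functionals -/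

instance : IsProbabilityMeasure
    (Measure.haarMeasure (⊤ : TopologicalSpace.PositiveCompacts Circle)) :=
  ⟨Measure.haarMeasure_self⟩

lemma integral_zpow_haarMeasure {k : ℤ} (hk : k ≠ 0) :
    ∫ z : Circle, (z : ℂ) ^ k
      ∂(Measure.haarMeasure (⊤ : TopologicalSpace.PositiveCompacts Circle)) = 0 := by
  set m := Measure.haarMeasure (⊤ : TopologicalSpace.PositiveCompacts Circle)
  -- Rotation by `exp(iπ/k)` changes the sign of `z^k`, so by invariance the integral equals its own
  -- negative.
  have hw : ((Circle.exp (Real.pi / k) : Circle) : ℂ) ^ k = -1 := by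
    have : (k : ℂ) ≠ 0 := by exact_mod_cast hk
    rw [Circle.coe_exp, ← Complex.exp_int_mul, ← Complex.exp_pi_mul_I]
    congr 1
    push_cast
    field_simp
  have h := integral_mul_left_eq_self (μ := m) (fun z : Circle => (z : ℂ) ^ k)
    (Circle.exp (Real.pi / k))
  simp only [Circle.coe_mul, mul_zpow, hw, neg_mul, one_mul, integral_neg] at h
  exact self_eq_neg.1 h.symm

lemma measureFunctional_haarCircle_monomial (n m : ℕ) :
    measureFunctional haarCircle (monomial n m) = if n = m then 1 else 0 := by
  rw [measureFunctional_apply, cintegral_haarCircle]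
  simp only [symbol_monomial]
  split_ifs with h
  · simp [h]
  · exact integral_zpow_haarMeasure (by omega)

lemma measureFunctional_mem (μ : CircleMeasure) : measureFunctional μ ∈ compactAnnihilator :=
  range_measureFunctional.le ⟨μ, rfl⟩

lemma isState_haarCircle : IsState (measureFunctional haarCircle) := by
  refine ⟨fun A => ?_, ?_⟩
  · rw [measureFunctional_apply, cintegral_haarCircle, map_mul, map_star]
    have h (z : Circle) : (star (symbol A) * symbol A) z = ((‖symbol A z‖ ^ 2 : ℝ) : ℂ) := by
      rw [Complex.ofReal_pow]
      exact Complex.conj_mul' _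
    simp only [h]
    rw [integral_complex_ofReal, Complex.zero_le_real]
    positivity
  · rw [← monomial_zero_zero, measureFunctional_haarCircle_monomial, if_pos rfl]

lemma apply_monomial_self {ρ : StrongDual ℂ toeplitz} (hρ : ρ ∈ compactAnnihilator) (n : ℕ) :
    ρ (monomial n n) = ρ 1 := by
  rw [← monomial_zero_zero, ← apply_monomial_add_left hρ n 0, zero_add]

lemma conv_comm (ρ φ : StrongDual ℂ toeplitz) : conv ρ φ = conv φ ρ :=
  dual_ext fun n m => by rw [conv_monomial, conv_monomial, mul_comm]

/-- The array of the Lebesgue functional lives on the diagonal, where any `ρ` in the annihilator is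
constantly `ρ(1)`; this is the scalar. -/
lemma isHaarFunctional_haarCircle :
    IsHaarFunctional compactAnnihilator (measureFunctional haarCircle) := by
  refine ⟨measureFunctional_mem _, isState_haarCircle, fun ρ hρ => ⟨ρ 1, ?_⟩⟩
  have h : conv (measureFunctional haarCircle) ρ = ρ 1 • measureFunctional haarCircle :=
    dual_ext fun n m => by
      rw [conv_monomial, smul_apply, measureFunctional_haarCircle_monomial]
      split_ifs with h
      · rw [h, apply_monomial_self hρ, smul_eq_mul, mul_comm]
      · rw [zero_mul, smul_zero]
  exact ⟨h, by rw [conv_comm, h]⟩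

/-- A Haar functional vanishes at every monomial where some normalized functional of the space
vanishes. -/
lemma IsHaarFunctional.monomial_eq_zero {V : Submodule ℂ (StrongDual ℂ toeplitz)}
    {h ρ : StrongDual ℂ toeplitz} (hh : IsHaarFunctional V h) (hρ : ρ ∈ V) (h1 : ρ 1 = 1)
    {n m : ℕ} (h0 : ρ (monomial n m) = 0) : h (monomial n m) = 0 := by
  obtain ⟨c, hc, -⟩ := hh.invariant ρ hρ
  -- At the unit both functionals equal `1`, which forces `c = 1`.
  have e1 := DFunLike.congr_fun hc (monomial 0 0)
  have e2 := DFunLike.congr_fun hc (monomial n m)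
  rw [conv_monomial, smul_apply, monomial_zero_zero, hh.isState.2, h1, mul_one, smul_eq_mul,
    mul_one] at e1
  rw [conv_monomial, smul_apply, h0, mul_zero, ← e1, one_smul] at e2
  exact e2.symm

/-- Membership in the annihilator fixes the diagonal values; the Lebesgue functional serves as the
test functional off the diagonal. -/
lemma IsHaarFunctional.eq_haarCircle {h : StrongDual ℂ toeplitz}
    (hh : IsHaarFunctional compactAnnihilator h) : h = measureFunctional haarCircle := by
  refine dual_ext fun n m => ?_
  rw [measureFunctional_haarCircle_monomial]
  split_ifs with hnm
  · rw [hnm, apply_monomial_self hh.mem, hh.isState.2]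
  · refine hh.monomial_eq_zero (measureFunctional_mem haarCircle) isState_haarCircle.2 ?_
    rw [measureFunctional_haarCircle_monomial, if_neg hnm]

/-- The vector state `A ↦ ⟨e₀, A e₀⟩`. -/
def vacuumState : StrongDual ℂ toeplitz :=
  (innerSL ℂ (stdBasis 0)) ∘L (ContinuousLinearMap.apply ℂ Ell2 (stdBasis 0)) ∘L
    toeplitz.toSubalgebra.toSubmodule.subtypeL

/-- `T*` kills `e_0`, and `Tⁿ e_0 = e_n` is orthogonal to `e_0` unless `n = 0`. -/
lemma vacuumState_monomial (n m : ℕ) :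
    vacuumState (monomial n m) = if n = 0 ∧ m = 0 then 1 else 0 := by
  have hn : (shift ^ n : Ell2 →L[ℂ] Ell2) (stdBasis 0) = stdBasis n := by
    induction n with
    | zero => rfl
    | succ n ih => rw [pow_succ', mul_apply_eq_comp, ih, shift_stdBasis]
  have h : vacuumState (monomial n m) = inner ℂ (stdBasis 0)
      ((shift ^ n : Ell2 →L[ℂ] Ell2) ((star shift ^ m : Ell2 →L[ℂ] Ell2) (stdBasis 0))) := rfl
  rw [h]
  cases m with
  | zero =>
    have e : (star shift ^ 0 : Ell2 →L[ℂ] Ell2) (stdBasis 0) = stdBasis 0 := rfl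
    rw [e, hn, orthonormal_iff_ite.1 orthonormal_stdBasis]
    simp [eq_comm]
  | succ m =>
    rw [pow_succ, mul_apply_eq_comp, star_shift_stdBasis_zero]
    simp

lemma isState_vacuumState : IsState vacuumState := by
  refine ⟨fun A => ?_, ?_⟩
  · have h : vacuumState (star A * A) = inner ℂ ((A : Ell2 →L[ℂ] Ell2) (stdBasis 0))
        ((A : Ell2 →L[ℂ] Ell2) (stdBasis 0)) :=
      ContinuousLinearMap.adjoint_inner_right (A : Ell2 →L[ℂ] Ell2) _ _
    rw [h, inner_self_eq_norm_sq_to_K]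
    exact pow_nonneg (Complex.zero_le_real.2 (norm_nonneg
      ((A : Ell2 →L[ℂ] Ell2) (stdBasis 0)))) 2
  · rw [← monomial_zero_zero, vacuumState_monomial, if_pos ⟨rfl, rfl⟩]

lemma isHaarFunctional_vacuumState : IsHaarFunctional ⊤ vacuumState := by
  refine ⟨trivial, isState_vacuumState, fun ρ _ => ⟨ρ 1, ?_⟩⟩
  have h : conv vacuumState ρ = ρ 1 • vacuumState :=
    dual_ext fun n m => by
      rw [conv_monomial, smul_apply, vacuumState_monomial]
      split_ifs with h
      · rw [h.1, h.2, monomial_zero_zero, smul_eq_mul, mul_comm]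
      · rw [zero_mul, smul_zero]
  exact ⟨h, by rw [conv_comm, h]⟩

lemma IsHaarFunctional.eq_vacuumState {h : StrongDual ℂ toeplitz}
    (hh : IsHaarFunctional ⊤ h) : h = vacuumState := by
  refine dual_ext fun n m => ?_
  rw [vacuumState_monomial]
  split_ifs with hnm
  · rw [hnm.1, hnm.2, monomial_zero_zero, hh.isState.2]
  · refine hh.monomial_eq_zero (ρ := vacuumState) trivial isState_vacuumState.2 ?_
    rw [vacuumState_monomial, if_neg hnm]

lemma measureFunctional_haarCircle_ne_vacuumState :
    measureFunctional haarCircle ≠ vacuumState := fun h => by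
  have := DFunLike.congr_fun h (monomial 1 1)
  rw [measureFunctional_haarCircle_monomial, vacuumState_monomial] at this
  simp at this

/-- Closure under the product is inherited from measures, so the comultiplication of a compact
operator never has to be examined. -/
lemma conv_mem_compactAnnihilator {ρ φ : StrongDual ℂ toeplitz} (hρ : ρ ∈ compactAnnihilator)
    (hφ : φ ∈ compactAnnihilator) : conv ρ φ ∈ compactAnnihilator := by
  obtain ⟨μ, rfl⟩ := range_measureFunctional.ge hρ
  obtain ⟨ν, rfl⟩ := range_measureFunctional.ge hφ
  rw [← measureFunctional_measureConv]
  exact measureFunctional_mem _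

end

end ToeplitzQS

theorem theorem10 :
    -- the annihilator of the compact operators is a subalgebra of the dual algebra
    (∀ ρ ∈ ToeplitzQS.compactAnnihilator, ∀ φ ∈ ToeplitzQS.compactAnnihilator,
      ToeplitzQS.conv ρ φ ∈ ToeplitzQS.compactAnnihilator) ∧
    -- integration of symbols is an algebra isomorphism from `M(S¹)` onto this subalgebra
    (Function.Injective ToeplitzQS.measureFunctional ∧
      LinearMap.range ToeplitzQS.measureFunctional = ToeplitzQS.compactAnnihilator ∧
      ∀ μ ν : ToeplitzQS.CircleMeasure,
        ToeplitzQS.measureFunctional (ToeplitzQS.measureConv μ ν) =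
          ToeplitzQS.conv (ToeplitzQS.measureFunctional μ) (ToeplitzQS.measureFunctional ν)) ∧
    ∃ h₀ : StrongDual ℂ ToeplitzQS.toeplitz,
      -- `h₀` is the unique Haar functional in the subalgebra
      ToeplitzQS.IsHaarFunctional ToeplitzQS.compactAnnihilator h₀ ∧
      (∀ h', ToeplitzQS.IsHaarFunctional ToeplitzQS.compactAnnihilator h' → h' = h₀) ∧
      (∀ n m : ℕ, h₀ (ToeplitzQS.monomial n m) = if n = m then 1 else 0) ∧
      -- it differs from the unique Haar functional in the whole dual algebra
      (∃ h : StrongDual ℂ ToeplitzQS.toeplitz,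
        ToeplitzQS.IsHaarFunctional ⊤ h ∧
        (∀ h', ToeplitzQS.IsHaarFunctional ⊤ h' → h' = h) ∧
        h₀ ≠ h) ∧
      -- it corresponds to normalized Haar measure under the isomorphism
      ToeplitzQS.measureFunctional ToeplitzQS.haarCircle = h₀ := by
  exact ⟨fun _ hρ _ hφ => ToeplitzQS.conv_mem_compactAnnihilator hρ hφ,
    ⟨ToeplitzQS.measureFunctional_injective, ToeplitzQS.range_measureFunctional,
      ToeplitzQS.measureFunctional_measureConv⟩,
    ToeplitzQS.measureFunctional ToeplitzQS.haarCircle, ToeplitzQS.isHaarFunctional_haarCircle,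
    fun _ hh => hh.eq_haarCircle, ToeplitzQS.measureFunctional_haarCircle_monomial,
    ⟨ToeplitzQS.vacuumState, ToeplitzQS.isHaarFunctional_vacuumState,
      fun _ hh => hh.eq_vacuumState, ToeplitzQS.measureFunctional_haarCircle_ne_vacuumState⟩, rfl⟩
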